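/- **Theorem 3 (One-stage aggregation).** Let $p,m,K\ge 1$ and let $f^{(1)},\dots,f^{(m)}$ be $C^1$ probability densities on $\Omega=[0,1]^p$. For $J\subseteq I=\{1,\dots,m\}$ put $Z_J=\int_\Omega\prod_{i\in J}f^{(i)}$ and $f_J=\prod_{i\in J}f^{(i)}/Z_J$, assume $Z_I>0$, and let $D=\max_{J\subseteq I}\|f_J\|_\infty$. For every $i$ let $\theta^{(i)}_1,\dots,\theta^{(i)}_N$ be drawn from $f^{(i)}$, all $mN$ draws being independent. For a partition of $(0,1]^p$ into $K$ blocks $A_k=\prod_{q}(l_{k,q},r_{k,q}]$ let $n_k^{(i)}$ be the number of points $\theta^{(i)}_j$ in $A_k$ and let $\hat f^{(i)}=\sum_{k}\frac{n^{(i)}_k}{N|A_k|}\mathbf 1_{A_k}$. The partition may be common to all $i$, or a separate one may be used for each $i$, and it is chosen in one of the following two ways, for a given $\delta>0$. * **ML.** Let $0<c_0<1$ and $\rho=K^{-1-1/(2p)}$. The common partition maximizes $\sum_{i=1}^m\frac1N\sum_{k}n^{(i)}_k\log\frac{n^{(i)}_k}{N|A_k|}$ over all partitions into $K$ blocks such that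 $n^{(i)}_k/N\ge c_0\rho$ for all $i,k$ and $|A_k|\ge\rho/D$ for all $k$; a separate partition for the index $i$ maximizes $\frac1N\sum_{k}n^{(i)}_k\log\frac{n^{(i)}_k}{N|A_k|}$ over all partitions into $K$ blocks such that $n^{(i)}_k/N\ge c_0\rho$ and $|A_k|\ge\rho/\|f^{(i)}\|_\infty$ for all $k$. (Maximization up to any additive tolerance $\eta\ge0$ is allowed.) The sample size satisfies $$N>2(1-c_0)^{-2}K^{1+\frac1{2p}}\log\frac{2K}\delta,\qquad \sqrt N\ge 32c_0^{-1}\sqrt{2(p+1)}\,K^{\frac32+\frac1{2p}}\sqrt{\log\Big(\frac{3eN}K\Big)\log\Big(\frac8\delta\Big)}.$$ * **KD.** The partition consists of the $K$ leaves, all at depth $\lfloor\log_2K\rfloor$ or $\lfloor\log_2K\rfloor+1$, of a binary tree in which each block is cut along one dimension at a median of the sample points in it. These are the points of the pooled sample for a common partition, and the points $\theta^{(i)}_j$ for a separate partition for the index $i$. The cut dimensions of the nodes are predetermined, or random and independent of the samples. The sample size satisfies $$N>32e^2(\log K)^2K\log\frac{2K}\delta,\qquad N>128e^2K(\log K)^2\log\frac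 K\delta.$$ Let $\varepsilon=\frac1m\sum_{i=1}^m\|f^{(i)}-\hat f^{(i)}\|_1$ and $\hat f_I=\prod_{i\in I}\hat f^{(i)}\big/\int\prod_{i\in I}\hat f^{(i)}$. Then in each case, with probability at least $1-m\delta$, $$\|f_I-\hat f_I\|_1\le\frac2{Z_I}\,m(2D)^{m-1}\varepsilon .$$ -/

import Mathlib

open MeasureTheory ProbabilityTheory

noncomputable section

namespace PART

/-- The parameter space `[0, 1]^p`. -/
def cube (p : ℕ) : Set (Fin p → ℝ) := Set.Icc 0 1

/-- A continuously differentiable probability density on `[0, 1]^p`. -/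
structure IsDensity {p : ℕ} (f : (Fin p → ℝ) → ℝ) : Prop where
  contDiffOn : ContDiffOn ℝ 1 f (cube p)
  nonneg : ∀ θ ∈ cube p, 0 ≤ f θ
  integral_eq_one : ∫ θ in cube p, f θ = 1

/-- The probability measure on `[0, 1]^p` with density `f`. -/
def law {p : ℕ} (f : (Fin p → ℝ) → ℝ) : Measure (Fin p → ℝ) :=
  (volume.restrict (cube p)).withDensity fun θ => ENNReal.ofReal (f θ)

/-- The supremum norm `‖g‖_∞` over `[0, 1]^p`. -/
def supNorm {p : ℕ} (g : (Fin p → ℝ) → ℝ) : ℝ := sSup ((fun θ => |g θ|) '' cube p)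

/-- The distance `‖g - h‖₁` on `[0, 1]^p`. -/
def l1Dist {p : ℕ} (g h : (Fin p → ℝ) → ℝ) : ℝ := ∫ θ in cube p, |g θ - h θ|

/-- The normalizing constant `Z_J = ∫ ∏_{i ∈ J} g i`. -/
def Z {p m : ℕ} (g : Fin m → (Fin p → ℝ) → ℝ) (J : Finset (Fin m)) : ℝ :=
  ∫ θ in cube p, ∏ i ∈ J, g i θ

/-- The normalized product `g_J = ∏_{i ∈ J} g i / Z_J`. -/
def aggregate {p m : ℕ} (g : Fin m → (Fin p → ℝ) → ℝ) (J : Finset (Fin m)) :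
    (Fin p → ℝ) → ℝ :=
  fun θ => (∏ i ∈ J, g i θ) / Z g J

/-- `D = max_J ‖f_J‖_∞` over all sets `J` of indices (for `J = ∅` the normalized product is the
constant `1`, which never exceeds the supremum of a density on `[0, 1]^p`). -/
def maxSup {p m : ℕ} (f : Fin m → (Fin p → ℝ) → ℝ) : ℝ :=
  ⨆ J : Finset (Fin m), supNorm (aggregate f J)

/-- The half-open unit cube `(0, 1]^p`, as a box. Boxes are the sets
`(l₁, r₁] × ⋯ × (l_p, r_p]` with `l_q < r_q`. -/
def unitBox (p : ℕ) : BoxIntegral.Box (Fin p) where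
  lower := 0
  upper := 1
  lower_lt_upper := fun _ => zero_lt_one

/-- The area `|B|` of a block. -/
def area {p : ℕ} (B : BoxIntegral.Box (Fin p)) : ℝ :=
  volume.real (B : Set (Fin p → ℝ))

open scoped Classical in
/-- The number of sample points in the block `B`. -/
def count {p : ℕ} {ι : Type*} [Fintype ι] (x : ι → Fin p → ℝ)
    (B : BoxIntegral.Box (Fin p)) : ℕ :=
  (Finset.univ.filter fun j => x j ∈ B).card

/-- The histogram `∑_k n_k / (N |A_k|) 1_{A_k}` of the sample `x` on the blocks of `A`. -/
def hist {p N : ℕ} (x : Fin N → Fin p → ℝ) (A : BoxIntegral.Prepartition (unitBox p)) :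
    (Fin p → ℝ) → ℝ :=
  fun θ => ∑ B ∈ A.boxes,
    (B : Set (Fin p → ℝ)).indicator (fun _ => (count x B : ℝ) / (N * area B)) θ

/-! ### Maximum likelihood partitions -/

/-- The empirical log-likelihood `∑_i (1/N) ∑_k n_k^{(i)} log (n_k^{(i)} / (N |A_k|))`, where
`i` ranges over the samples that are partitioned together. -/
def logLik {p N : ℕ} {κ : Type*} [Fintype κ] (x : κ → Fin N → Fin p → ℝ)
    (A : BoxIntegral.Prepartition (unitBox p)) : ℝ :=
  ∑ i, (1 / (N : ℝ)) *
    ∑ B ∈ A.boxes, (count (x i) B : ℝ) * Real.log ((count (x i) B : ℝ) / (N * area B))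

/-- Partitions of the cube into `K` blocks with `n_k^{(i)} / N ≥ c₀ ρ` and `|A_k| ≥ ρ / D`. -/
structure IsMLFeasible {p N : ℕ} {κ : Type*} [Fintype κ] (x : κ → Fin N → Fin p → ℝ)
    (K : ℕ) (c₀ ρ D : ℝ) (A : BoxIntegral.Prepartition (unitBox p)) : Prop where
  isPartition : A.IsPartition
  card_eq : A.boxes.card = K
  count_ge : ∀ i, ∀ B ∈ A, c₀ * ρ ≤ (count (x i) B : ℝ) / N
  area_ge : ∀ B ∈ A, ρ / D ≤ area B

/-- `A` maximizes the empirical log-likelihood over the feasible partitions, up to an additive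
tolerance `η`; for `η = 0` it is an exact maximizer. (The supremum need not be attained, because
the blocks are half-open; approximate maximizers exist as soon as a feasible partition does.) -/
structure IsMLPartition {p N : ℕ} {κ : Type*} [Fintype κ] (x : κ → Fin N → Fin p → ℝ)
    (K : ℕ) (c₀ ρ D η : ℝ) (A : BoxIntegral.Prepartition (unitBox p)) : Prop where
  feasible : IsMLFeasible x K c₀ ρ D A
  optimal : ∀ A' : BoxIntegral.Prepartition (unitBox p),
    IsMLFeasible x K c₀ ρ D A' → logLik x A' ≤ logLik x A + η

/-! ### Median (KD-tree) partitions -/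

open scoped Classical in
/-- `c` is a median of the `q`-th coordinates of the sample points in the block `B`. -/
def IsMedian {p : ℕ} {ι : Type*} [Fintype ι] (x : ι → Fin p → ℝ)
    (B : BoxIntegral.Box (Fin p)) (q : Fin p) (c : ℝ) : Prop :=
  count x B ≤ 2 * (Finset.univ.filter fun j => x j ∈ B ∧ x j q ≤ c).card ∧
  count x B ≤ 2 * (Finset.univ.filter fun j => x j ∈ B ∧ c ≤ x j q).card

open scoped Classical in
/-- `IsKDTree x dir d a B S`: the blocks in `S` are the leaves of a median partition tree on the
block `B`, which sits at the node with address `a` of the whole tree (the length of `a` is its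
depth). A block at the node `a` is cut along the dimension `dir a`, at a median of the sample points
in it, into its parts `{θ_q ≤ c}` and `{θ_q > c}`. All leaves have depth `d` or `d + 1`. -/
inductive IsKDTree {p : ℕ} {ι : Type*} [Fintype ι] (x : ι → Fin p → ℝ)
    (dir : List Bool → Fin p) (d : ℕ) :
    List Bool → BoxIntegral.Box (Fin p) → Finset (BoxIntegral.Box (Fin p)) → Prop
  | leaf (a : List Bool) (B : BoxIntegral.Box (Fin p)) (ha : d ≤ a.length) :
      IsKDTree x dir d a B {B}
  | cut (a : List Bool) (B L R : BoxIntegral.Box (Fin p)) (c : ℝ)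
      (S T : Finset (BoxIntegral.Box (Fin p))) (ha : a.length ≤ d)
      (hc : IsMedian x B (dir a) c)
      (hL : (L : WithBot (BoxIntegral.Box (Fin p))) = B.splitLower (dir a) c)
      (hR : (R : WithBot (BoxIntegral.Box (Fin p))) = B.splitUpper (dir a) c)
      (hS : IsKDTree x dir d (false :: a) L S) (hT : IsKDTree x dir d (true :: a) R T) :
      IsKDTree x dir d a B (S ∪ T)

/-- `A` is the set of `K` leaves of a balanced median partition tree on the cube, where all leaves
have depth `⌊log₂ K⌋` or `⌊log₂ K⌋ + 1`. -/
def IsKDPartition {p : ℕ} {ι : Type*} [Fintype ι] (x : ι → Fin p → ℝ)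
    (dir : List Bool → Fin p) (K : ℕ) (A : BoxIntegral.Prepartition (unitBox p)) : Prop :=
  IsKDTree x dir (Nat.log 2 K) [] (unitBox p) A.boxes ∧ A.boxes.card = K

/-! ### Aggregation -/

/-- The average `ε` of the errors `‖f^{(i)} - f̂^{(i)}‖₁`. -/
def avgError {p m : ℕ} (f fhat : Fin m → (Fin p → ℝ) → ℝ) : ℝ :=
  (∑ i, l1Dist (f i) (fhat i)) / m

/-- The bound `‖f_I - f̂_I‖₁ ≤ (2 / Z_I) m (2D)^{m-1} ε` on the error of the aggregated density. -/
def AggregationBound {p m : ℕ} (f fhat : Fin m → (Fin p → ℝ) → ℝ) : Prop :=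
  l1Dist (aggregate f Finset.univ) (aggregate fhat Finset.univ) ≤
    2 / Z f Finset.univ * (m * (2 * maxSup f) ^ (m - 1) * avgError f fhat)

end PART

end

/-! The error bound is deterministic once every histogram is bounded by `2 * maxSup f`. Replacing
the factors one at a time gives `|∏ f i - ∏ fhat i| ≤ (2D)^(m-1) ∑ |f i - fhat i|`
(`abs_prod_sub_prod_le`). Integration turns the sum into `m` times the average error, and
normalization costs `2 / Z` (`integral_abs_div_sub_div_le`). Both are combined in
`aggregationBound_of_le`.

A histogram value is `n / (N |C|)`, and `f i ≤ D` bounds the probability of `C` by `D |C|`. It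
therefore suffices that empirical frequencies are at most twice the probabilities, uniformly over
all blocks that can occur. Blocks are intersections of half-spaces. Quantile grids enclose all
intersections of `r` half-spaces of fixed dimensions and sides in `(M + 1) ^ r` sets, each region
with an excess of probability of at most `r / M` (`exists_cover_region`). A Chernoff bound and a
union bound over these sets then give `exists_uniform_countIn_region_le` for regions holding a
fraction at least `α` of the sample.

For ML, a block has `2p` faces and `α = 2ρ`; a block with fewer points satisfies the bound because
its area is at least `ρ / D`. For KD, a leaf is described by the cuts on its path, about `log₂ K`
half-spaces, so the dimension `p` does not enter. Medians keep at least a fraction `2 / (5K)` of the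
partitioned points in each leaf, and independence of the cut dimensions allows conditioning on the
path (`exists_uniform_countIn_path_le`). -/

noncomputable section

namespace PART

/-! ### Products of bounded functions -/

lemma abs_prod_sub_prod_le {ι : Type*} (s : Finset ι) (a b : ι → ℝ) {B : ℝ}
    (ha : ∀ i ∈ s, 0 ≤ a i ∧ a i ≤ B) (hb : ∀ i ∈ s, 0 ≤ b i ∧ b i ≤ B) :
    |∏ i ∈ s, a i - ∏ i ∈ s, b i| ≤ B ^ (s.card - 1) * ∑ i ∈ s, |a i - b i| := by
  classical
  induction s using Finset.induction_on with
  | empty => simp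
  | insert i s his ih =>
    have ih := ih (fun j hj => ha j (Finset.mem_insert_of_mem hj))
      (fun j hj => hb j (Finset.mem_insert_of_mem hj))
    have hai := ha i (Finset.mem_insert_self i s)
    have hbi := hb i (Finset.mem_insert_self i s)
    have hB : 0 ≤ B := hai.1.trans hai.2
    have hprod : |∏ j ∈ s, a j| ≤ B ^ s.card := by
      rw [Finset.abs_prod]
      calc ∏ j ∈ s, |a j| ≤ ∏ _j ∈ s, B := by
            refine Finset.prod_le_prod (fun _ _ => abs_nonneg _) fun j hj => ?_
            have := ha j (Finset.mem_insert_of_mem hj)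
            rw [abs_of_nonneg this.1]
            exact this.2
        _ = B ^ s.card := by simp
    -- For empty `s` the truncated exponent makes the powers of `B` differ, but the sum vanishes.
    have hrest : B * (B ^ (s.card - 1) * ∑ j ∈ s, |a j - b j|) =
        B ^ s.card * ∑ j ∈ s, |a j - b j| := by
      rcases s.eq_empty_or_nonempty with rfl | hs
      · simp
      · have : s.card = (s.card - 1) + 1 := by have := hs.card_pos; omega
        conv_rhs => rw [this, pow_succ]
        ring
    rw [Finset.prod_insert his, Finset.prod_insert his, Finset.sum_insert his,
      Finset.card_insert_of_notMem his, Nat.add_sub_cancel]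
    calc |a i * ∏ j ∈ s, a j - b i * ∏ j ∈ s, b j|
        = |(a i - b i) * ∏ j ∈ s, a j + b i * (∏ j ∈ s, a j - ∏ j ∈ s, b j)| := by
          congr 1; ring
      _ ≤ |a i - b i| * |∏ j ∈ s, a j| + b i * |∏ j ∈ s, a j - ∏ j ∈ s, b j| := by
          refine (abs_add_le _ _).trans ?_
          rw [abs_mul, abs_mul, abs_of_nonneg hbi.1]
      _ ≤ |a i - b i| * B ^ s.card + B * (B ^ (s.card - 1) * ∑ j ∈ s, |a j - b j|) := by
          refine add_le_add (mul_le_mul_of_nonneg_left hprod (abs_nonneg _)) ?_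
          exact mul_le_mul hbi.2 ih (abs_nonneg _) hB
      _ = B ^ s.card * (|a i - b i| + ∑ j ∈ s, |a j - b j|) := by
          rw [hrest]; ring

/-- Normalizing two nonnegative functions at most doubles their relative distance. -/
lemma integral_abs_div_sub_div_le {α : Type*} [MeasurableSpace α] {ν : Measure α} {P Q : α → ℝ}
    (hP : Integrable P ν) (hQ : Integrable Q ν) (hP0 : 0 ≤ᵐ[ν] P) (hQ0 : 0 ≤ᵐ[ν] Q)
    (hZ : 0 < ∫ x, P x ∂ν) :
    ∫ x, |P x / (∫ y, P y ∂ν) - Q x / (∫ y, Q y ∂ν)| ∂ν ≤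
      2 / (∫ x, P x ∂ν) * ∫ x, |P x - Q x| ∂ν := by
  set z := ∫ x, P x ∂ν with hz
  set w := ∫ x, Q x ∂ν with hw
  have hdiff : |z - w| ≤ ∫ x, |P x - Q x| ∂ν := by
    rw [hz, hw, ← integral_sub hP hQ]
    exact abs_integral_le_integral_abs
  have hPQ : Integrable (fun x => |P x - Q x|) ν := (hP.sub hQ).abs
  have hw0 : 0 ≤ w := integral_nonneg_of_ae hQ0
  -- The histograms may have a product of integral zero. Division by zero then makes the second
  -- function zero, so the left side is `1`, while `∫ |P - Q| ≥ z` makes the right side at least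
  -- `2`.
  rcases hw0.eq_or_lt with h | h
  · rw [← h] at hdiff ⊢
    rw [sub_zero, abs_of_pos hZ] at hdiff
    have : ∫ x, |P x / z - Q x / 0| ∂ν = 1 := by
      have : ∀ᵐ x ∂ν, |P x / z - Q x / 0| = P x / z := by
        filter_upwards [hP0] with x hx
        simp only [div_zero, sub_zero]
        exact abs_of_nonneg (div_nonneg hx hZ.le)
      rw [integral_congr_ae this, integral_div, ← hz, div_self hZ.ne']
    rw [this, div_mul_eq_mul_div, le_div_iff₀ hZ]
    linarith
  · have key : ∀ᵐ x ∂ν, |P x / z - Q x / w| ≤ |P x - Q x| / z + Q x * (|z - w| / (z * w)) := by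
      filter_upwards [hQ0] with x hx
      -- The last term integrates to `|z - w| / z` in absolute value, which is again at most `∫ |P -
      -- Q| / z`; hence the factor 2.
      have : P x / z - Q x / w = (P x - Q x) / z + Q x * (-(z - w) / (z * w)) := by
        field_simp
        ring
      rw [this]
      refine (abs_add_le _ _).trans ?_
      rw [abs_div, abs_mul, abs_div, abs_neg, abs_of_nonneg (show 0 ≤ Q x from hx),
        abs_of_pos hZ, abs_of_pos (mul_pos hZ h)]
    calc ∫ x, |P x / z - Q x / w| ∂ν
        ≤ ∫ x, (|P x - Q x| / z + Q x * (|z - w| / (z * w))) ∂ν :=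
          integral_mono_ae ((hP.div_const z).sub (hQ.div_const w)).abs
            ((hPQ.div_const z).add (hQ.mul_const _)) key
      _ = (∫ x, |P x - Q x| ∂ν) / z + w * (|z - w| / (z * w)) := by
          rw [integral_add (hPQ.div_const z) (hQ.mul_const _), integral_div, integral_mul_const]
      _ = ((∫ x, |P x - Q x| ∂ν) + |z - w|) / z := by field_simp
      _ ≤ ((∫ x, |P x - Q x| ∂ν) + ∫ x, |P x - Q x| ∂ν) / z := by gcongr
      _ = 2 / z * ∫ x, |P x - Q x| ∂ν := by ring

/-! ### Densities on the cube -/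

variable {p m N : ℕ}

lemma isCompact_cube (p : ℕ) : IsCompact (cube p) := isCompact_Icc

lemma measurableSet_cube (p : ℕ) : MeasurableSet (cube p) := (isCompact_cube p).measurableSet

lemma volume_real_cube (p : ℕ) : volume.real (cube p) = 1 := by
  simp [cube, measureReal_def, Real.volume_Icc_pi]

instance : IsFiniteMeasure (volume.restrict (cube p)) :=
  ⟨by rw [Measure.restrict_apply_univ]; exact (isCompact_cube p).measure_lt_top⟩

lemma le_supNorm {g : (Fin p → ℝ) → ℝ} (hg : ContinuousOn g (cube p)) {θ : Fin p → ℝ}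
    (hθ : θ ∈ cube p) : g θ ≤ supNorm g :=
  (le_abs_self _).trans <|
    le_csSup ((isCompact_cube p).bddAbove_image hg.abs) (Set.mem_image_of_mem _ hθ)

namespace IsDensity

variable {g : (Fin p → ℝ) → ℝ}

lemma continuousOn (hg : IsDensity g) : ContinuousOn g (cube p) := hg.contDiffOn.continuousOn

lemma integrableOn (hg : IsDensity g) : IntegrableOn g (cube p) :=
  hg.continuousOn.integrableOn_compact (isCompact_cube p)

lemma one_le_supNorm (hg : IsDensity g) : 1 ≤ supNorm g := by
  rw [← hg.integral_eq_one]
  calc ∫ θ in cube p, g θ ≤ ∫ _θ in cube p, supNorm g :=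
        setIntegral_mono_on hg.integrableOn (integrable_const _) (measurableSet_cube p)
          fun θ hθ => le_supNorm hg.continuousOn hθ
    _ = supNorm g := by simp [volume_real_cube]

end IsDensity

lemma supNorm_le_maxSup {f : Fin m → (Fin p → ℝ) → ℝ} (hf : ∀ i, IsDensity (f i)) (i : Fin m) :
    supNorm (f i) ≤ maxSup f := by
  have h : aggregate f {i} = f i := by
    ext θ
    simp [aggregate, Z, (hf i).integral_eq_one]
  rw [← h]
  exact le_ciSup (f := fun J : Finset (Fin m) => supNorm (aggregate f J))
    (Set.finite_range _).bddAbove {i}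

lemma le_maxSup {f : Fin m → (Fin p → ℝ) → ℝ} (hf : ∀ i, IsDensity (f i)) (i : Fin m)
    {θ : Fin p → ℝ} (hθ : θ ∈ cube p) : f i θ ≤ maxSup f :=
  (le_supNorm (hf i).continuousOn hθ).trans (supNorm_le_maxSup hf i)

lemma one_le_maxSup {f : Fin m → (Fin p → ℝ) → ℝ} (hf : ∀ i, IsDensity (f i)) (i : Fin m) :
    1 ≤ maxSup f :=
  (hf i).one_le_supNorm.trans (supNorm_le_maxSup hf i)

/-- The aggregation bound holds for estimates that are bounded by `2 D`. -/
theorem aggregationBound_of_le (hm : 1 ≤ m) {f fhat : Fin m → (Fin p → ℝ) → ℝ}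
    (hf : ∀ i, IsDensity (f i)) (hZ : 0 < Z f Finset.univ) (hmeas : ∀ i, Measurable (fhat i))
    (hnonneg : ∀ i θ, 0 ≤ fhat i θ) (hle : ∀ i θ, fhat i θ ≤ 2 * maxSup f) :
    AggregationBound f fhat := by
  have hD : 1 ≤ maxSup f := one_le_maxSup hf ⟨0, hm⟩
  have hfhat : ∀ i, IntegrableOn (fhat i) (cube p) := fun i =>
    Integrable.of_bound (hmeas i).aestronglyMeasurable (2 * maxSup f) <| .of_forall fun θ => by
      rw [Real.norm_of_nonneg (hnonneg i θ)]; exact hle i θ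
  have hP : IntegrableOn (fun θ => ∏ i, f i θ) (cube p) :=
    (continuousOn_finsetProd _ fun i _ => (hf i).continuousOn).integrableOn_compact
      (isCompact_cube p)
  have hQ : IntegrableOn (fun θ => ∏ i, fhat i θ) (cube p) := by
    refine Integrable.of_bound
      (Finset.measurable_fun_prod _ fun i _ => hmeas i).aestronglyMeasurable
      (∏ _i : Fin m, 2 * maxSup f) <| .of_forall fun θ => ?_
    rw [Real.norm_of_nonneg (Finset.prod_nonneg fun i _ => hnonneg i θ)]
    exact Finset.prod_le_prod (fun i _ => hnonneg i θ) fun i _ => hle i θ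
  have hP0 : ∀ᵐ θ ∂volume.restrict (cube p), 0 ≤ ∏ i, f i θ :=
    ae_restrict_of_forall_mem (measurableSet_cube p) fun θ hθ =>
      Finset.prod_nonneg fun i _ => (hf i).nonneg θ hθ
  have hQ0 : ∀ᵐ θ ∂volume.restrict (cube p), 0 ≤ ∏ i, fhat i θ :=
    .of_forall fun θ => Finset.prod_nonneg fun i _ => hnonneg i θ
  have hdist : ∀ i, IntegrableOn (fun θ => |f i θ - fhat i θ|) (cube p) := fun i =>
    ((hf i).integrableOn.sub (hfhat i)).abs
  have hsum : ∫ θ in cube p, |∏ i, f i θ - ∏ i, fhat i θ| ≤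
      (2 * maxSup f) ^ (m - 1) * ∑ i, l1Dist (f i) (fhat i) := by
    calc ∫ θ in cube p, |∏ i, f i θ - ∏ i, fhat i θ|
        ≤ ∫ θ in cube p, (2 * maxSup f) ^ (m - 1) * ∑ i, |f i θ - fhat i θ| := by
          refine setIntegral_mono_on (hP.sub hQ).abs
            ((integrable_finsetSum _ fun i _ => hdist i).const_mul _) (measurableSet_cube p) ?_
          intro θ hθ
          have := abs_prod_sub_prod_le Finset.univ (fun i => f i θ) (fun i => fhat i θ)
            (B := 2 * maxSup f)
            (fun i _ => ⟨(hf i).nonneg θ hθ, by linarith [le_maxSup hf i hθ]⟩)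
            (fun i _ => ⟨hnonneg i θ, hle i θ⟩)
          simpa using this
      _ = (2 * maxSup f) ^ (m - 1) * ∑ i, l1Dist (f i) (fhat i) := by
          rw [integral_const_mul, integral_finsetSum _ fun i _ => hdist i]
          rfl
  have hmne : (m : ℝ) ≠ 0 := by positivity
  calc l1Dist (aggregate f Finset.univ) (aggregate fhat Finset.univ)
      ≤ 2 / Z f Finset.univ * ∫ θ in cube p, |∏ i, f i θ - ∏ i, fhat i θ| :=
        integral_abs_div_sub_div_le hP hQ hP0 hQ0 hZ
    _ ≤ 2 / Z f Finset.univ * ((2 * maxSup f) ^ (m - 1) * ∑ i, l1Dist (f i) (fhat i)) := by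
        gcongr
    _ = 2 / Z f Finset.univ * (m * (2 * maxSup f) ^ (m - 1) * avgError f fhat) := by
        rw [avgError]
        field_simp

/-! ### Histograms -/

lemma area_pos (B : BoxIntegral.Box (Fin p)) : 0 < area B := by
  rw [area, measureReal_def, BoxIntegral.Box.coe_eq_pi, Real.volume_pi_Ioc_toReal B.lower_le_upper]
  exact Finset.prod_pos fun q _ => sub_pos.2 (B.lower_lt_upper q)

lemma area_unitBox : area (unitBox p) = 1 := by
  rw [area, measureReal_def, BoxIntegral.Box.coe_eq_pi,
    Real.volume_pi_Ioc_toReal (unitBox p).lower_le_upper]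
  simp [unitBox]

lemma measurable_hist (x : Fin N → Fin p → ℝ) (A : BoxIntegral.Prepartition (unitBox p)) :
    Measurable (hist x A) :=
  Finset.measurable_fun_sum _ fun B _ => measurable_const.indicator B.measurableSet_coe

lemma hist_nonneg (x : Fin N → Fin p → ℝ) (A : BoxIntegral.Prepartition (unitBox p))
    (θ : Fin p → ℝ) : 0 ≤ hist x A θ :=
  Finset.sum_nonneg fun B _ => Set.indicator_nonneg (fun _ _ => by
    have := area_pos B
    positivity) _

lemma hist_le {x : Fin N → Fin p → ℝ} {A : BoxIntegral.Prepartition (unitBox p)} {c : ℝ}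
    (hc : 0 ≤ c) (h : ∀ B ∈ A, (count x B : ℝ) ≤ c * (N * area B)) (θ : Fin p → ℝ) :
    hist x A θ ≤ c := by
  by_cases hθ : ∃ B ∈ A.boxes, θ ∈ (B : Set (Fin p → ℝ))
  · obtain ⟨B, hB, hθB⟩ := hθ
    -- Blocks are disjoint, so only the block containing `θ` contributes.
    rw [hist, Finset.sum_eq_single_of_mem B hB, Set.indicator_of_mem hθB]
    · have := area_pos B
      exact div_le_of_le_mul₀ (by positivity) hc (h B hB)
    · intro B' hB' hne
      refine Set.indicator_of_notMem (fun hθB' => ?_) _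
      exact Set.disjoint_left.1 (A.pairwiseDisjoint hB' hB hne) hθB' hθB
  · rw [hist, Finset.sum_eq_zero]
    · exact hc
    · intro B hB
      exact Set.indicator_of_notMem (fun hθB => hθ ⟨B, hB, hθB⟩) _

/-! ### The law of a sample point -/

lemma law_absolutelyContinuous (g : (Fin p → ℝ) → ℝ) : law g ≪ volume :=
  (withDensity_absolutelyContinuous _ _).trans Measure.restrict_le_self.absolutelyContinuous

lemma law_real_le {g : (Fin p → ℝ) → ℝ} {c : ℝ} (hc : 0 ≤ c) (hg : ∀ θ ∈ cube p, g θ ≤ c)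
    (B : BoxIntegral.Box (Fin p)) : (law g).real B ≤ c * area B := by
  have h : law g B ≤ ENNReal.ofReal c * volume (B : Set (Fin p → ℝ)) := by
    rw [law, withDensity_apply _ B.measurableSet_coe]
    calc ∫⁻ θ in B, ENNReal.ofReal (g θ) ∂volume.restrict (cube p)
        ≤ ∫⁻ _θ in B, ENNReal.ofReal c ∂volume.restrict (cube p) := by
          refine lintegral_mono_ae (ae_restrict_of_ae ?_)
          exact ae_restrict_of_forall_mem (measurableSet_cube p) fun θ hθ =>
            ENNReal.ofReal_le_ofReal (hg θ hθ)
      _ = ENNReal.ofReal c * volume.restrict (cube p) B := by simp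
      _ ≤ ENNReal.ofReal c * volume (B : Set (Fin p → ℝ)) := by
          gcongr
          exact Measure.restrict_le_self
  have hfin : volume (B : Set (Fin p → ℝ)) ≠ ⊤ := by
    rw [BoxIntegral.Box.coe_eq_pi, Real.volume_pi_Ioc]
    exact ENNReal.prod_ne_top fun _ _ => ENNReal.ofReal_ne_top
  rw [measureReal_def, area, measureReal_def]
  calc (law g B).toReal ≤ (ENNReal.ofReal c * volume (B : Set (Fin p → ℝ))).toReal :=
        ENNReal.toReal_mono (ENNReal.mul_ne_top ENNReal.ofReal_ne_top hfin) h
    _ = c * (volume (B : Set (Fin p → ℝ))).toReal := by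
        rw [ENNReal.toReal_mul, ENNReal.toReal_ofReal hc]

lemma law_hyperplane (g : (Fin p → ℝ) → ℝ) (q : Fin p) (t : ℝ) : law g {x | x q = t} = 0 := by
  refine law_absolutelyContinuous g ?_
  have := Measure.ae_eval_ne (fun _ : Fin p => (volume : Measure ℝ)) q t
  simpa [ae_iff, volume_pi] using this

lemma law_compl_unitBox (g : (Fin p → ℝ) → ℝ) :
    law g (unitBox p : Set (Fin p → ℝ))ᶜ = 0 := by
  have hae : (unitBox p : Set (Fin p → ℝ)) =ᵐ[volume] cube p := by
    rw [BoxIntegral.Box.coe_eq_pi, volume_pi]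
    exact Measure.univ_pi_Ioc_ae_eq_Icc
  have h : (volume.restrict (cube p)) (unitBox p : Set (Fin p → ℝ))ᶜ = 0 := by
    rw [Measure.restrict_apply (unitBox p).measurableSet_coe.compl]
    have : ((unitBox p : Set (Fin p → ℝ))ᶜ ∩ cube p : Set (Fin p → ℝ)) =ᵐ[volume]
        ((cube p)ᶜ ∩ cube p : Set (Fin p → ℝ)) := hae.compl.inter (ae_eq_refl _)
    rw [measure_congr this]
    simp
  exact withDensity_absolutelyContinuous _ _ h

/-! ### Quantile covers -/

/-- This says that a distribution function evaluated at its own variable is not stochastically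
smaller than a uniform variable. The set is closed downwards, so up to at most one point, which is
null, it is a directed countable union of rational half-lines of measure at most `a`. -/
lemma measure_setOf_measure_Iic_le (ν : Measure ℝ) (h0 : ∀ t, ν {t} = 0) (a : ENNReal) :
    ν {t | ν (Set.Iic t) ≤ a} ≤ a := by
  set S := {t | ν (Set.Iic t) ≤ a} with hS
  set Q := {q : ℚ | (q : ℝ) ∈ S} with hQ
  have hmono : ∀ {s t : ℝ}, s ≤ t → t ∈ S → s ∈ S := fun hst ht =>
    (measure_mono (Set.Iic_subset_Iic.2 hst)).trans ht
  have hsub : (S \ ⋃ q ∈ Q, Set.Iic (q : ℝ)).Subsingleton := by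
    have key : ∀ s ∈ S \ ⋃ q ∈ Q, Set.Iic (q : ℝ), ∀ t ∈ S \ ⋃ q ∈ Q, Set.Iic (q : ℝ),
        ¬ s < t := by
      intro s hs t ht hst
      obtain ⟨q, hsq, hqt⟩ := exists_rat_btwn hst
      exact hs.2 (Set.mem_biUnion (show q ∈ Q from hmono hqt.le ht.1) hsq.le)
    intro s hs t ht
    exact le_antisymm (not_lt.1 (key t ht s hs)) (not_lt.1 (key s hs t ht))
  have hnull : ν (S \ ⋃ q ∈ Q, Set.Iic (q : ℝ)) = 0 := by
    rcases hsub.eq_empty_or_singleton with h | ⟨t, h⟩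
    · rw [h, measure_empty]
    · rw [h, h0]
  have hunion : ν (⋃ q ∈ Q, Set.Iic (q : ℝ)) ≤ a := by
    rw [measure_biUnion_eq_iSup Q.to_countable]
    · exact iSup₂_le fun q hq => hq
    · intro q hq r hr
      refine ⟨max q r, ?_, ?_, ?_⟩
      · rcases max_choice q r with h | h <;> rw [h] <;> assumption
      · exact Set.Iic_subset_Iic.2 (by exact_mod_cast le_max_left q r)
      · exact Set.Iic_subset_Iic.2 (by exact_mod_cast le_max_right q r)
  calc ν S ≤ ν ((S \ ⋃ q ∈ Q, Set.Iic (q : ℝ)) ∪ ⋃ q ∈ Q, Set.Iic (q : ℝ)) :=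
        measure_mono (by rw [Set.sdiff_union_self]; exact Set.subset_union_left)
    _ ≤ 0 + a := (measure_union_le _ _).trans (add_le_add hnull.le hunion)
    _ = a := zero_add a

/-- The half-line `(c, ∞)` or `(-∞, c]`. -/
def halfLine (b : Bool) (c : ℝ) : Set ℝ := if b then Set.Ioi c else Set.Iic c

/-- The covering sets are the sublevel sets of the distribution function at the levels `j / M`,
which avoids choosing quantiles. Rounding `M * ν.real (Iic c)` up gives the index for `c`. -/
lemma exists_cover_Iic (ν : Measure ℝ) [IsProbabilityMeasure ν] (h0 : ∀ t, ν {t} = 0) {M : ℕ}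
    (hM : 1 ≤ M) :
    ∃ cov : Fin (M + 1) → Set ℝ, (∀ j, MeasurableSet (cov j)) ∧
      ∀ c, ∃ j, Set.Iic c ⊆ cov j ∧ ν.real (cov j) ≤ ν.real (Set.Iic c) + 1 / M := by
  have hM0 : (0 : ℝ) < M := by positivity
  have hmono : Monotone fun t => ν (Set.Iic t) := fun s t hst =>
    measure_mono (Set.Iic_subset_Iic.2 hst)
  refine ⟨fun j => {t | ν (Set.Iic t) ≤ ENNReal.ofReal ((j : ℕ) / M)}, fun j =>
    measurableSet_le hmono.measurable measurable_const, fun c => ?_⟩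
  have hle : ν.real (Set.Iic c) ≤ 1 := measureReal_le_one
  have hceil : ⌈M * ν.real (Set.Iic c)⌉₊ ≤ M := Nat.ceil_le.2 (by nlinarith)
  have hc : ν (Set.Iic c) ≤ ENNReal.ofReal ((⌈M * ν.real (Set.Iic c)⌉₊ : ℕ) / M) := by
    rw [← ofReal_measureReal]
    refine ENNReal.ofReal_le_ofReal ?_
    rw [le_div_iff₀ hM0, mul_comm]
    exact Nat.le_ceil _
  refine ⟨⟨_, Nat.lt_succ_of_le hceil⟩, fun t ht => (hmono ht).trans hc, ?_⟩
  have h1 := ENNReal.toReal_mono ENNReal.ofReal_ne_top (measure_setOf_measure_Iic_le ν h0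
    (ENNReal.ofReal ((⌈M * ν.real (Set.Iic c)⌉₊ : ℕ) / M)))
  rw [ENNReal.toReal_ofReal (by positivity)] at h1
  refine h1.trans ?_
  have h2 := Nat.ceil_lt_add_one (show 0 ≤ M * ν.real (Set.Iic c) by positivity)
  rw [div_le_iff₀ hM0, add_mul, one_div, inv_mul_cancel₀ hM0.ne']
  linarith

lemma exists_cover_halfLine (ν : Measure ℝ) [IsProbabilityMeasure ν] (h0 : ∀ t, ν {t} = 0)
    {M : ℕ} (hM : 1 ≤ M) (b : Bool) :
    ∃ cov : Fin (M + 1) → Set ℝ, (∀ j, MeasurableSet (cov j)) ∧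
      ∀ c, ∃ j, halfLine b c ⊆ cov j ∧ ν.real (cov j) ≤ ν.real (halfLine b c) + 1 / M := by
  cases b with
  | false => simpa [halfLine] using exists_cover_Iic ν h0 hM
  | true =>
    -- Reflection reduces upper half-lines to lower ones; it produces closed half-lines, which have
    -- the same measure since there are no atoms.
    have hneg : ∀ s : Set ℝ, MeasurableSet s → ν.map Neg.neg s = ν (Neg.neg ⁻¹' s) :=
      fun s hs => Measure.map_apply measurable_neg hs
    have := Measure.isProbabilityMeasure_map (μ := ν) measurable_neg.aemeasurable
    obtain ⟨cov, hcov, h⟩ := exists_cover_Iic (ν.map Neg.neg)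
      (fun t => by rw [hneg _ (measurableSet_singleton t)]; simpa using h0 (-t)) hM
    refine ⟨fun j => Neg.neg ⁻¹' cov j, fun j => measurable_neg (hcov j), fun c => ?_⟩
    obtain ⟨j, hj, hle⟩ := h (-c)
    refine ⟨j, fun t ht => hj ?_, ?_⟩
    · simp only [halfLine, if_true, Set.mem_Ioi] at ht
      simpa using ht.le
    · have hIci : ν (Set.Ici c) = ν (Set.Ioi c) := by
        refine le_antisymm ?_ (measure_mono Set.Ioi_subset_Ici_self)
        rw [← Set.Ioi_union_left]
        refine (measure_union_le _ _).trans ?_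
        rw [h0, add_zero]
      simp only [measureReal_def, hneg _ (hcov j), hneg _ measurableSet_Iic] at hle ⊢
      simpa [halfLine, hIci] using hle

/-- The set of points that lie in a given family of half-spaces. -/
def region {p : ℕ} {κ : Type*} (s : κ → Fin p × Bool) (c : κ → ℝ) : Set (Fin p → ℝ) :=
  {x | ∀ k, x (s k).1 ∈ halfLine (s k).2 (c k)}

/-- Each half-space is enlarged separately in its one-dimensional marginal. A point gained by the
intersection is gained by some half-space, so the excesses `1 / M` add up over `κ`. -/
lemma exists_cover_region {p : ℕ} (ν : Measure (Fin p → ℝ)) [IsProbabilityMeasure ν]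
    (h0 : ∀ q t, ν {x | x q = t} = 0) {κ : Type*} [Fintype κ] (s : κ → Fin p × Bool) {M : ℕ}
    (hM : 1 ≤ M) :
    ∃ cov : (κ → Fin (M + 1)) → Set (Fin p → ℝ), (∀ j, MeasurableSet (cov j)) ∧
      ∀ c, ∃ j, region s c ⊆ cov j ∧
        ν.real (cov j) ≤ ν.real (region s c) + Fintype.card κ / M := by
  have hcov : ∀ k : κ, ∃ cov : Fin (M + 1) → Set ℝ, (∀ j, MeasurableSet (cov j)) ∧
      ∀ c, ∃ j, halfLine (s k).2 c ⊆ cov j ∧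
        (ν.map fun x => x (s k).1).real (cov j) ≤
          (ν.map fun x => x (s k).1).real (halfLine (s k).2 c) + 1 / M := by
    intro k
    have hq : Measurable fun x : Fin p → ℝ => x (s k).1 := measurable_pi_apply _
    have := Measure.isProbabilityMeasure_map (μ := ν) hq.aemeasurable
    exact exists_cover_halfLine _ (fun t => by
      rw [Measure.map_apply hq (measurableSet_singleton t)]; exact h0 _ t) hM _
  choose cov hmeas hcov using hcov
  have hmeas' : ∀ k j, MeasurableSet {x : Fin p → ℝ | x (s k).1 ∈ cov k j} := fun k j =>
    measurable_pi_apply (s k).1 (hmeas k j)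
  refine ⟨fun j => {x | ∀ k, x (s k).1 ∈ cov k (j k)}, fun j => ?_, fun c => ?_⟩
  · simp only [Set.ofPred_forall]
    exact MeasurableSet.iInter fun k => hmeas' k (j k)
  choose j hj hle using fun k => hcov k (c k)
  refine ⟨j, fun x hx k => hj k (hx k), ?_⟩
  have hhalf : ∀ k, MeasurableSet (halfLine (s k).2 (c k)) := fun k => by
    unfold halfLine; split_ifs <;> measurability
  have hsub : {x : Fin p → ℝ | ∀ k, x (s k).1 ∈ cov k (j k)} ⊆
      region s c ∪ ⋃ k, {x | x (s k).1 ∈ cov k (j k) \ halfLine (s k).2 (c k)} := by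
    intro x hx
    by_cases hxr : x ∈ region s c
    · exact Or.inl hxr
    · simp only [region, Set.mem_ofPred_eq, not_forall] at hxr
      obtain ⟨k, hk⟩ := hxr
      exact Or.inr (Set.mem_iUnion.2 ⟨k, hx k, hk⟩)
  have hk : ∀ k, ν.real {x | x (s k).1 ∈ cov k (j k) \ halfLine (s k).2 (c k)} ≤ 1 / M := by
    intro k
    have hq : Measurable fun x : Fin p → ℝ => x (s k).1 := measurable_pi_apply _
    have := Measure.isProbabilityMeasure_map (μ := ν) hq.aemeasurable
    have h1 := measureReal_sdiff (μ := ν.map fun x => x (s k).1) (hj k) (hhalf k)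
    rw [measureReal_def, Measure.map_apply hq ((hmeas k _).diff (hhalf k)), ← measureReal_def] at h1
    have := hle k
    change ν.real ((fun x : Fin p → ℝ => x (s k).1) ⁻¹' _) ≤ _
    linarith
  calc ν.real {x | ∀ k, x (s k).1 ∈ cov k (j k)}
      ≤ ν.real (region s c) +
          ν.real (⋃ k, {x | x (s k).1 ∈ cov k (j k) \ halfLine (s k).2 (c k)}) :=
        (measureReal_mono hsub).trans (measureReal_union_le _ _)
    _ ≤ ν.real (region s c) + ∑ _k : κ, 1 / (M : ℝ) := by
        gcongr
        exact (measureReal_iUnion_fintype_le _).trans (Finset.sum_le_sum fun k _ => hk k)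
    _ = ν.real (region s c) + Fintype.card κ / M := by
        rw [Finset.sum_const, Finset.card_univ, nsmul_eq_mul, mul_one_div]

/-! ### Deviations of counts -/

open scoped Classical in
/-- The number of sample points in the set `s`. -/
def countIn {ι β : Type*} [Fintype ι] (x : ι → β) (s : Set β) : ℕ :=
  (Finset.univ.filter fun j => x j ∈ s).card

lemma countIn_mono {ι β : Type*} [Fintype ι] (x : ι → β) {s t : Set β} (h : s ⊆ t) :
    countIn x s ≤ countIn x t :=
  Finset.card_le_card fun j hj => by
    simp only [Finset.mem_filter, Finset.mem_univ, true_and] at hj ⊢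
    exact h hj

lemma countIn_eq_sum {ι β : Type*} [Fintype ι] (x : ι → β) (s : Set β) :
    (countIn x s : ℝ) = ∑ j, s.indicator (fun _ => (1 : ℝ)) (x j) := by
  classical
  simp [countIn, Set.indicator_apply, Finset.sum_boole]

lemma measurable_countIn {ι β : Type*} [Fintype ι] [MeasurableSpace β] {s : Set β}
    (hs : MeasurableSet s) : Measurable fun x : ι → β => (countIn x s : ℝ) := by
  simp_rw [countIn_eq_sum]
  exact Finset.measurable_fun_sum _ fun j _ =>
    (measurable_const.indicator hs).comp (measurable_pi_apply j)

/-- A Chernoff bound: a count is unlikely to exceed its mean by the factor `5 / 3`. -/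
lemma measureReal_le_countIn_le {Ω β : Type*} [MeasurableSpace Ω] [MeasurableSpace β]
    {μ : Measure Ω} [IsProbabilityMeasure μ] {N : ℕ} {Y : Fin N → Ω → β}
    (hY : ∀ j, Measurable (Y j)) (hindep : iIndepFun Y μ) {ν : Measure β}
    (hlaw : ∀ j, μ.map (Y j) = ν) {s : Set β} (hs : MeasurableSet s) {a : ℝ}
    (ha : N * ν.real s ≤ 3 / 5 * a) :
    μ.real {ω | a ≤ countIn (fun j => Y j ω) s} ≤ Real.exp (-(a / 10)) := by
  set W : Fin N → Ω → ℝ := fun j ω => s.indicator (fun _ => (1 : ℝ)) (Y j ω) with hW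
  have hind : Measurable (s.indicator fun _ => (1 : ℝ)) := measurable_const.indicator hs
  have hWm : ∀ j, Measurable (W j) := fun j => hind.comp (hY j)
  have hWi : iIndepFun W μ := hindep.comp (fun _ => s.indicator fun _ => (1 : ℝ)) fun _ => hind
  have hcount : ∀ ω, (countIn (fun j => Y j ω) s : ℝ) = (∑ j, W j) ω := fun ω => by
    rw [countIn_eq_sum, Finset.sum_apply]
  have hmgf : ∀ j, mgf (W j) μ (1 / 2) = 1 + (Real.exp (1 / 2) - 1) * ν.real s := by
    intro j
    have h1 : ∀ ω, Real.exp (1 / 2 * W j ω) =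
        1 + (Real.exp (1 / 2) - 1) * (Y j ⁻¹' s).indicator (fun _ => (1 : ℝ)) ω := by
      intro ω
      by_cases h : Y j ω ∈ s <;> simp [hW, h]
    have hYs : MeasurableSet (Y j ⁻¹' s) := hY j hs
    rw [mgf]
    simp_rw [h1]
    rw [integral_add (integrable_const _)
      (((integrable_const (1 : ℝ)).indicator hYs).const_mul _), integral_const_mul,
      integral_indicator_const _ hYs, ← hlaw j, measureReal_def, measureReal_def (μ := μ.map _),
      Measure.map_apply (hY j) hs]
    simp [measureReal_def]
  have hint : Integrable (fun ω => Real.exp (1 / 2 * (∑ j, W j) ω)) μ := by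
    refine Integrable.of_bound (C := Real.exp (1 / 2 * N)) ?_ (.of_forall fun ω => ?_)
    · have : Measurable (∑ j, W j) := by
        rw [Finset.sum_fn]
        exact Finset.measurable_sum _ fun j _ => hWm j
      exact (Real.measurable_exp.comp (this.const_mul _)).aestronglyMeasurable
    · rw [Real.norm_of_nonneg (Real.exp_nonneg _)]
      gcongr
      rw [Finset.sum_apply]
      calc ∑ j, W j ω ≤ ∑ _j : Fin N, (1 : ℝ) :=
            Finset.sum_le_sum fun j _ => Set.indicator_le_self' (fun _ _ => zero_le_one) _
        _ = N := by simp
  -- With Chernoff parameter `1 / 2`, this makes the exponent at most `-a/2 + (2/3)(3/5)a = -a/10`.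
  have hexp : Real.exp (1 / 2) ≤ 5 / 3 := by
    have h1 : Real.exp (1 / 2) ^ 2 = Real.exp 1 := by rw [← Real.exp_nat_mul]; norm_num
    have := Real.exp_one_lt_d9
    nlinarith [Real.exp_pos (1 / 2)]
  have hexp1 : 1 ≤ Real.exp (1 / 2) := Real.one_le_exp (by norm_num)
  have hν : 0 ≤ ν.real s := measureReal_nonneg
  simp_rw [hcount]
  refine (measure_ge_le_exp_mul_mgf a (by norm_num : (0 : ℝ) ≤ 1 / 2) hint).trans ?_
  rw [hWi.mgf_sum hWm, Finset.prod_congr rfl fun j _ => hmgf j, Finset.prod_const,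
    Finset.card_univ, Fintype.card_fin]
  calc Real.exp (-(1 / 2) * a) * (1 + (Real.exp (1 / 2) - 1) * ν.real s) ^ N
      ≤ Real.exp (-(1 / 2) * a) * Real.exp ((Real.exp (1 / 2) - 1) * ν.real s) ^ N := by
        have := Real.add_one_le_exp ((Real.exp (1 / 2) - 1) * ν.real s)
        have : 0 ≤ (Real.exp (1 / 2) - 1) * ν.real s := mul_nonneg (by linarith) hν
        gcongr
        linarith
    _ = Real.exp (-(1 / 2) * a + (Real.exp (1 / 2) - 1) * (N * ν.real s)) := by
        rw [← Real.exp_nat_mul, ← Real.exp_add]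
        congr 1
        ring
    _ ≤ Real.exp (-(a / 10)) := by
        refine Real.exp_le_exp.2 ?_
        have : (Real.exp (1 / 2) - 1) * (N * ν.real s) ≤ 2 / 3 * (3 / 5 * a) :=
          mul_le_mul (by linarith) ha (by positivity) (by norm_num)
        linarith

/-- Uniformly over all regions of a given pattern that contain a fraction of at least `α` of the
sample, the empirical frequency is at most twice the probability. -/
theorem exists_uniform_countIn_region_le {Ω : Type*} [MeasurableSpace Ω] {μ : Measure Ω}
    [IsProbabilityMeasure μ] {p N : ℕ} {Y : Fin N → Ω → Fin p → ℝ}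
    (hY : ∀ j, Measurable (Y j)) (hindep : iIndepFun Y μ) {ν : Measure (Fin p → ℝ)}
    [IsProbabilityMeasure ν] (hlaw : ∀ j, μ.map (Y j) = ν) (h0 : ∀ q t, ν {x | x q = t} = 0)
    {κ : Type*} [Fintype κ] (s : κ → Fin p × Bool) {M : ℕ} (hM : 1 ≤ M) {α : ℝ}
    (hα : 10 * Fintype.card κ ≤ α * M) :
    ∃ G : Set (Fin N → Fin p → ℝ), MeasurableSet G ∧
      μ.real ((fun ω j => Y j ω) ⁻¹' Gᶜ) ≤
        (M + 1) ^ Fintype.card κ * Real.exp (-(α * N / 10)) ∧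
      ∀ x ∈ G, ∀ c, α * N ≤ countIn x (region s c) →
        (countIn x (region s c) : ℝ) ≤ 2 * (N * ν.real (region s c)) := by
  classical
  obtain ⟨cov, hcov, h⟩ := exists_cover_region ν h0 s hM
  -- The second term meets the mean condition of the Chernoff bound; the first keeps every failure
  -- probability below `exp (-(α * N / 10))`, even for sets of tiny measure.
  set a : (κ → Fin (M + 1)) → ℝ := fun j => max (α * N) (5 / 3 * (N * ν.real (cov j))) with ha
  refine ⟨⋂ j, {x | a j ≤ countIn x (cov j)}ᶜ, MeasurableSet.iInter fun j =>
    (measurableSet_le measurable_const (measurable_countIn (hcov j))).compl, ?_, ?_⟩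
  · rw [Set.compl_iInter, Set.preimage_iUnion]
    calc μ.real (⋃ j, (fun ω i => Y i ω) ⁻¹' ({x | a j ≤ countIn x (cov j)}ᶜ)ᶜ)
        ≤ ∑ _j : κ → Fin (M + 1), Real.exp (-(α * N / 10)) := by
          refine (measureReal_iUnion_fintype_le _).trans (Finset.sum_le_sum fun j _ => ?_)
          rw [compl_compl]
          refine (measureReal_le_countIn_le hY hindep hlaw (hcov j) (a := a j) ?_).trans ?_
          · have := le_max_right (α * N) (5 / 3 * (N * ν.real (cov j)))
            simp only [ha]
            linarith
          · refine Real.exp_le_exp.2 ?_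
            have := le_max_left (α * N) (5 / 3 * (N * ν.real (cov j)))
            simp only [ha]
            linarith
      _ = (M + 1) ^ Fintype.card κ * Real.exp (-(α * N / 10)) := by
          rw [Finset.sum_const, nsmul_eq_mul, Finset.card_univ, Fintype.card_fun, Fintype.card_fin]
          push_cast
          ring
  · intro x hx c hc
    obtain ⟨j, hj, hle⟩ := h c
    have hxj : (countIn x (cov j) : ℝ) < a j := by
      simpa using Set.mem_iInter.1 hx j
    have hcount : (countIn x (region s c) : ℝ) ≤ countIn x (cov j) := by
      exact_mod_cast countIn_mono x hj
    have hM0 : (0 : ℝ) < M := by positivity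
    have hr : (Fintype.card κ : ℝ) / M ≤ α / 10 := by
      rw [div_le_div_iff₀ hM0 (by norm_num)]
      linarith
    -- The first case contradicts `hc`. In the second, the count is at most `5/3 N ν + αN/6`, and
    -- `αN` is at most the count itself, which leaves the factor `(5/3) / (5/6) = 2`.
    rcases lt_max_iff.1 hxj with h1 | h1
    · linarith
    · have : (N : ℝ) * ν.real (cov j) ≤ N * (ν.real (region s c) + α / 10) := by
        gcongr
        linarith
      linarith

/-! ### Blocks of a median partition tree -/

variable {p : ℕ}

lemma count_eq_countIn {ι : Type*} [Fintype ι] (x : ι → Fin p → ℝ)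
    (B : BoxIntegral.Box (Fin p)) : count x B = countIn x (B : Set (Fin p → ℝ)) := rfl

/-- The half-spaces that cut out the node `a` of a tree with cut dimensions `dir`. -/
def pathPattern (dir : List Bool → Fin p) (a : List Bool) : Fin a.length → Fin p × Bool :=
  -- The head of an address is its latest turn, so turn `k` was taken at the ancestor `a.drop (k +
  -- 1)`.
  fun k => (dir (a.drop (k + 1)), a.get k)

lemma region_pathPattern_cons (dir : List Bool → Fin p) (a : List Bool) (b : Bool) (t : ℝ)
    (c : Fin a.length → ℝ) :
    region (pathPattern dir (b :: a)) (Fin.cons t c : Fin (a.length + 1) → ℝ) =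
      region (pathPattern dir a) c ∩ {x | x (dir a) ∈ halfLine b t} := by
  ext x
  constructor
  · intro h
    exact ⟨fun k => h k.succ, h (0 : Fin (a.length + 1))⟩
  · rintro ⟨h, h'⟩ k
    exact Fin.cases (motive := fun k : Fin (a.length + 1) =>
      x (pathPattern dir (b :: a) k).1 ∈ halfLine (pathPattern dir (b :: a) k).2
        ((Fin.cons t c : Fin (a.length + 1) → ℝ) k)) h' h k

lemma count_le_two_mul_of_isMedian_lower {ι : Type*} [Fintype ι] {x : ι → Fin p → ℝ}
    {B L : BoxIntegral.Box (Fin p)} {q : Fin p} {c : ℝ} (hc : IsMedian x B q c)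
    (hL : (L : Set (Fin p → ℝ)) = (B : Set (Fin p → ℝ)) ∩ {y | y q ≤ c}) : count x B ≤ 2 * count x L := by
  refine hc.1.trans (Nat.mul_le_mul_left 2 (le_of_eq ?_))
  rw [count_eq_countIn, hL, countIn]
  congr

/-- The cut itself belongs to the lower part. Without ties in the coordinate `q`, at most one sample
point is lost this way. -/
lemma count_le_two_mul_of_isMedian_upper {ι : Type*} [Fintype ι] {x : ι → Fin p → ℝ}
    {B R : BoxIntegral.Box (Fin p)} {q : Fin p} {c : ℝ}
    (hx : Function.Injective fun j => x j q) (hc : IsMedian x B q c)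
    (hR : (R : Set (Fin p → ℝ)) = (B : Set (Fin p → ℝ)) ∩ {y | c < y q}) : count x B ≤ 2 * (count x R + 1) := by
  classical
  refine hc.2.trans (Nat.mul_le_mul_left 2 ?_)
  have hone : (Finset.univ.filter fun j => x j q = c).card ≤ 1 :=
    Finset.card_le_one.2 fun i hi j hj => hx <| by
      simp only [Finset.mem_filter, Finset.mem_univ, true_and] at hi hj
      exact hi.trans hj.symm
  rw [count_eq_countIn, hR, countIn]
  refine le_trans ?_ (Nat.add_le_add_left hone _)
  refine le_trans (Finset.card_le_card fun j hj => ?_) (Finset.card_union_le _ _)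
  simp only [Finset.mem_filter, Finset.mem_univ, true_and, Finset.mem_union, Set.mem_inter_iff,
    Set.mem_ofPred_eq] at hj ⊢
  rcases hj.2.lt_or_eq with h | h
  · exact Or.inl ⟨hj.1, h⟩
  · exact Or.inr h.symm

lemma coe_eq_of_splitLower {B L : BoxIntegral.Box (Fin p)} {q : Fin p} {c : ℝ}
    (hL : (L : WithBot (BoxIntegral.Box (Fin p))) = B.splitLower q c) :
    (L : Set (Fin p → ℝ)) = (B : Set (Fin p → ℝ)) ∩ {y | y q ≤ c} := by
  rw [← BoxIntegral.Box.coe_splitLower, ← hL, BoxIntegral.Box.coe_coe]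

lemma coe_eq_of_splitUpper {B R : BoxIntegral.Box (Fin p)} {q : Fin p} {c : ℝ}
    (hR : (R : WithBot (BoxIntegral.Box (Fin p))) = B.splitUpper q c) :
    (R : Set (Fin p → ℝ)) = (B : Set (Fin p → ℝ)) ∩ {y | c < y q} := by
  rw [← BoxIntegral.Box.coe_splitUpper, ← hR, BoxIntegral.Box.coe_coe]

/-- Every leaf is cut out by the half-spaces on its path, and the medians split the sample
evenly. -/
lemma IsKDTree.leaf_region {ι : Type*} [Fintype ι] {x : ι → Fin p → ℝ}
    {dir : List Bool → Fin p} {d : ℕ} (hx : ∀ q, Function.Injective fun j => x j q)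
    {a : List Bool} {B : BoxIntegral.Box (Fin p)} {S : Finset (BoxIntegral.Box (Fin p))}
    (h : IsKDTree x dir d a B S) (U : Set (Fin p → ℝ)) (n : ℕ) (had : a.length ≤ d + 1)
    (c : Fin a.length → ℝ) (hB : (B : Set (Fin p → ℝ)) = U ∩ region (pathPattern dir a) c)
    (hn : n + 2 ≤ 2 ^ a.length * (count x B + 2)) :
    ∀ C ∈ S, ∃ a' : List Bool, (a'.length = d ∨ a'.length = d + 1) ∧
      (∃ c' : Fin a'.length → ℝ,
        (C : Set (Fin p → ℝ)) = U ∩ region (pathPattern dir a') c') ∧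
      n + 2 ≤ 2 ^ a'.length * (count x C + 2) := by
  classical
  induction h with
  | leaf a B ha =>
    intro C hC
    rw [Finset.mem_singleton] at hC
    subst hC
    exact ⟨a, by omega, ⟨c, hB⟩, hn⟩
  | cut a B L R t S T ha hc hL hR hS hT ihS ihT =>
    intro C hC
    have hL' := coe_eq_of_splitLower hL
    have hR' := coe_eq_of_splitUpper hR
    rcases Finset.mem_union.1 hC with hC | hC
    · refine ihS (by simpa using ha) (Fin.cons t c) ?_ ?_ C hC
      · rw [region_pathPattern_cons, hL', hB, Set.inter_assoc]
        rfl
      · have := count_le_two_mul_of_isMedian_lower hc hL'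
        calc n + 2 ≤ 2 ^ a.length * (count x B + 2) := hn
          _ ≤ 2 ^ a.length * (2 * (count x L + 2)) := by gcongr; omega
          _ = 2 ^ (false :: a).length * (count x L + 2) := by
            rw [List.length_cons, pow_succ]; ring
    · refine ihT (by simpa using ha) (Fin.cons t c) ?_ ?_ C hC
      · rw [region_pathPattern_cons, hR', hB, Set.inter_assoc]
        rfl
      -- The shift by 2 is stable under the loss of one point: `count B ≤ 2 (count R + 1)` is `count
      -- B + 2 ≤ 2 (count R + 2)`.
      · have := count_le_two_mul_of_isMedian_upper (hx _) hc hR'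
        calc n + 2 ≤ 2 ^ a.length * (count x B + 2) := hn
          _ ≤ 2 ^ a.length * (2 * (count x R + 2)) := by gcongr; omega
          _ = 2 ^ (true :: a).length * (count x R + 2) := by
            rw [List.length_cons, pow_succ]; ring

lemma IsKDTree.nonempty_and_le {ι : Type*} [Fintype ι] {x : ι → Fin p → ℝ}
    {dir : List Bool → Fin p} {d : ℕ} {a : List Bool} {B : BoxIntegral.Box (Fin p)}
    {S : Finset (BoxIntegral.Box (Fin p))} (h : IsKDTree x dir d a B S) :
    S.Nonempty ∧ ∀ C ∈ S, (C : Set (Fin p → ℝ)) ⊆ B := by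
  classical
  induction h with
  | leaf a B ha => simp
  | cut a B L R t S T ha hc hL hR hS hT ihS ihT =>
    refine ⟨ihS.1.mono Finset.subset_union_left, fun C hC => ?_⟩
    rcases Finset.mem_union.1 hC with hC | hC
    · refine (ihS.2 C hC).trans ?_
      rw [coe_eq_of_splitLower hL]
      exact Set.inter_subset_left
    · refine (ihT.2 C hC).trans ?_
      rw [coe_eq_of_splitUpper hR]
      exact Set.inter_subset_left

/-- After a cut both sides have leaves; if these were one box, its upper corner would lie on both
sides of the cut. -/
lemma IsKDTree.eq_singleton_of_card_eq_one {ι : Type*} [Fintype ι] {x : ι → Fin p → ℝ}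
    {dir : List Bool → Fin p} {d : ℕ} {a : List Bool} {B : BoxIntegral.Box (Fin p)}
    {S : Finset (BoxIntegral.Box (Fin p))} (h : IsKDTree x dir d a B S) (hS : S.card = 1) :
    S = {B} := by
  classical
  cases h with
  | leaf => rfl
  | cut _ _ L R t S T ha hc hL hR hS' hT =>
    exfalso
    obtain ⟨⟨C, hC⟩, hCL⟩ := hS'.nonempty_and_le
    obtain ⟨⟨C', hC'⟩, hCR⟩ := hT.nonempty_and_le
    have hCC : C = C' := Finset.card_le_one.1 hS.le C (Finset.mem_union_left _ hC) C'
      (Finset.mem_union_right _ hC')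
    subst hCC
    have h1 := hCL C hC C.upper_mem
    have h2 := hCR C hC' C.upper_mem
    rw [coe_eq_of_splitLower hL] at h1
    rw [coe_eq_of_splitUpper hR] at h2
    have h3 : C.upper (dir a) ≤ t := h1.2
    exact absurd h2.2 (not_lt.2 h3)

/-- Every block is cut out by the `2 p` half-spaces of its faces. -/
lemma coe_box_eq_region (B : BoxIntegral.Box (Fin p)) :
    (B : Set (Fin p → ℝ)) =
      region (id : Fin p × Bool → Fin p × Bool)
        (fun k => if k.2 then B.lower k.1 else B.upper k.1) := by
  ext x
  constructor
  · rintro hx ⟨q, _ | _⟩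
    · exact (hx q).2
    · exact (hx q).1
  · exact fun hx q => ⟨hx (q, true), hx (q, false)⟩

/-! ### Median partitions with random cut dimensions -/

lemma measurable_pathPattern (a : List Bool) :
    Measurable fun dir : List Bool → Fin p => pathPattern dir a :=
  measurable_pi_lambda _ fun _ => (measurable_pi_apply _).prodMk measurable_const

/-- The uniform bound on counts for the nodes of a tree, for cut dimensions that are independent of
the sample. -/
theorem exists_uniform_countIn_path_le {Ω : Type*} [MeasurableSpace Ω] {μ : Measure Ω}
    [IsProbabilityMeasure μ] {N : ℕ} {Y : Fin N → Ω → Fin p → ℝ}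
    (hY : ∀ j, Measurable (Y j)) (hindep : iIndepFun Y μ) {ν : Measure (Fin p → ℝ)}
    [IsProbabilityMeasure ν] (hlaw : ∀ j, μ.map (Y j) = ν) (h0 : ∀ q t, ν {x | x q = t} = 0)
    {dir : Ω → List Bool → Fin p} (hdir : Measurable dir)
    (hdirY : IndepFun dir (fun ω j => Y j ω) μ) (𝒜 : Finset (List Bool)) {r M : ℕ}
    (h𝒜 : ∀ a ∈ 𝒜, a.length ≤ r) (hM : 1 ≤ M) {α : ℝ} (hα : 10 * r ≤ α * M) :
    ∃ E : Set Ω, MeasurableSet E ∧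
      μ.real Eᶜ ≤ 𝒜.card * ((M + 1) ^ r * Real.exp (-(α * N / 10))) ∧
      ∀ ω ∈ E, ∀ a ∈ 𝒜, ∀ c,
        α * N ≤ countIn (fun j => Y j ω) (region (pathPattern (dir ω) a) c) →
        (countIn (fun j => Y j ω) (region (pathPattern (dir ω) a) c) : ℝ) ≤
          2 * (N * ν.real (region (pathPattern (dir ω) a) c)) := by
  have hsample : Measurable fun ω j => Y j ω := measurable_pi_lambda _ hY
  have hG : ∀ a : {a // a ∈ 𝒜}, ∀ s : Fin a.1.length → Fin p × Bool,
      ∃ G : Set (Fin N → Fin p → ℝ), MeasurableSet G ∧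
        μ.real ((fun ω j => Y j ω) ⁻¹' Gᶜ) ≤ (M + 1) ^ r * Real.exp (-(α * N / 10)) ∧
        ∀ x ∈ G, ∀ c, α * N ≤ countIn x (region s c) →
          (countIn x (region s c) : ℝ) ≤ 2 * (N * ν.real (region s c)) := by
    intro a s
    have hlen : (a.1.length : ℝ) ≤ r := by exact_mod_cast h𝒜 _ a.2
    obtain ⟨G, hG, hμ, h⟩ := exists_uniform_countIn_region_le hY hindep hlaw h0 s hM (α := α)
      (by rw [Fintype.card_fin]; linarith)
    refine ⟨G, hG, hμ.trans ?_, h⟩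
    rw [Fintype.card_fin]
    gcongr
    · linarith [(Nat.cast_nonneg M : (0 : ℝ) ≤ M)]
    · exact h𝒜 _ a.2
  choose G hGm hGμ hG using hG
  have hpath : ∀ a : List Bool, Measurable fun ω => pathPattern (dir ω) a := fun a =>
    (measurable_pathPattern a).comp hdir
  set bad : {a // a ∈ 𝒜} → Set Ω := fun a => ⋃ s,
    (fun ω => pathPattern (dir ω) a.1) ⁻¹' {s} ∩ (fun ω j => Y j ω) ⁻¹' (G a s)ᶜ with hbad
  have hbadm : ∀ a, MeasurableSet (bad a) := fun a => MeasurableSet.iUnion fun s =>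
    (hpath a.1 (measurableSet_singleton s)).inter (hsample (hGm a s).compl)
  have hbadμ : ∀ a, μ.real (bad a) ≤ (M + 1) ^ r * Real.exp (-(α * N / 10)) := by
    intro a
    -- The pattern has finitely many values and is independent of the sample. The probabilities of
    -- its values sum to 1, so random cut dimensions cost no extra factor.
    have hind : IndepFun (fun ω => pathPattern (dir ω) a.1) (fun ω j => Y j ω) μ :=
      hdirY.comp (measurable_pathPattern a.1) measurable_id
    calc μ.real (bad a)
        ≤ ∑ s, μ.real ((fun ω => pathPattern (dir ω) a.1) ⁻¹' {s} ∩
            (fun ω j => Y j ω) ⁻¹' (G a s)ᶜ) := measureReal_iUnion_fintype_le _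
      _ ≤ ∑ s, μ.real ((fun ω => pathPattern (dir ω) a.1) ⁻¹' {s}) *
            ((M + 1) ^ r * Real.exp (-(α * N / 10))) := by
          refine Finset.sum_le_sum fun s _ => ?_
          rw [measureReal_def, hind.measure_inter_preimage_eq_mul _ _ (measurableSet_singleton s)
            (hGm a s).compl, ENNReal.toReal_mul]
          exact mul_le_mul_of_nonneg_left (hGμ a s) measureReal_nonneg
      _ = (M + 1) ^ r * Real.exp (-(α * N / 10)) := by
          rw [← Finset.sum_mul, sum_measureReal_preimage_singleton Finset.univ
            (fun s _ => hpath a.1 (measurableSet_singleton s))]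
          simp
  refine ⟨(⋃ a, bad a)ᶜ, (MeasurableSet.iUnion hbadm).compl, ?_, ?_⟩
  · rw [compl_compl]
    refine (measureReal_iUnion_fintype_le _).trans ?_
    refine (Finset.sum_le_sum fun a _ => hbadμ a).trans ?_
    rw [Finset.sum_const, nsmul_eq_mul, Finset.card_univ, Fintype.card_coe]
  · intro ω hω a ha c
    refine hG ⟨a, ha⟩ (pathPattern (dir ω) a) _ ?_ c
    by_contra hnot
    exact hω (Set.mem_iUnion.2 ⟨⟨a, ha⟩, Set.mem_iUnion.2 ⟨_, rfl, hnot⟩⟩)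

/-! ### Sample sizes -/

/-- This is the union bound for the `2p` faces of a box with `α = 2 / R`. The choice `M = ⌈10pR⌉`
gives `M + 1 ≤ 12pR ≤ exp (2lR)`, so the logarithm of the cover size is at most `4plR`, far below `N
/ (5R)`. -/
lemma exists_grid_size {p : ℕ} (hp : 1 ≤ p) {N R l δ : ℝ} (hR1 : 1 ≤ R) (hl1 : 1 ≤ l)
    (hδ : 0 < δ) (hδ1 : δ < 1) (hlp : Real.log (12 * p) ≤ l)
    (hN : 2048 * (p + 1) * R ^ 2 * (l * (2 + -Real.log δ)) ≤ N) :
    ∃ M : ℕ, 1 ≤ M ∧ 10 * Fintype.card (Fin p × Bool) ≤ 2 * R⁻¹ * M ∧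
      (M + 1) ^ Fintype.card (Fin p × Bool) * Real.exp (-(2 * R⁻¹ * N / 10)) ≤ δ := by
  have hp1 : (1 : ℝ) ≤ p := by exact_mod_cast hp
  have hℓ0 : 0 < -Real.log δ := neg_pos.2 (Real.log_neg hδ hδ1)
  set ℓ := -Real.log δ with hℓ
  refine ⟨⌈10 * p * R⌉₊, Nat.ceil_pos.2 (by positivity), ?_, ?_⟩
  · have h1 := Nat.le_ceil (10 * p * R)
    rw [Fintype.card_prod, Fintype.card_fin, Fintype.card_bool]
    calc (10 : ℝ) * ((p * 2 : ℕ) : ℝ) = 2 * R⁻¹ * (10 * p * R) := by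
          push_cast; field_simp
      _ ≤ 2 * R⁻¹ * ⌈10 * p * R⌉₊ := by gcongr
  · have h1 : (⌈10 * p * R⌉₊ : ℝ) + 1 ≤ 12 * p * R := by
      have := Nat.ceil_lt_add_one (show 0 ≤ 10 * p * R by positivity)
      nlinarith
    have h2 : Real.log (12 * p * R) ≤ 2 * l * R := by
      rw [Real.log_mul (by positivity) (by positivity)]
      have h5 := Real.log_le_self (show 0 ≤ R by positivity)
      have h6 := mul_nonneg (sub_nonneg.2 hl1) (sub_nonneg.2 hR1)
      have h7 : 1 ≤ l * R := one_le_mul_of_one_le_of_one_le hl1 hR1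
      linarith
    have h3 : (⌈10 * p * R⌉₊ : ℝ) + 1 ≤ Real.exp (2 * l * R) :=
      h1.trans ((Real.log_le_iff_le_exp (by positivity)).1 h2)
    have h4 : 2048 * (p + 1) * R * (l * (2 + ℓ)) ≤ N / R := by
      rw [le_div_iff₀ (by positivity)]
      linarith
    rw [Fintype.card_prod, Fintype.card_fin, Fintype.card_bool]
    calc ((⌈10 * p * R⌉₊ : ℝ) + 1) ^ (p * 2) * Real.exp (-(2 * R⁻¹ * N / 10))
        ≤ Real.exp (2 * l * R) ^ (p * 2) * Real.exp (-(2 * R⁻¹ * N / 10)) := by gcongr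
      _ = Real.exp (4 * p * (l * R) - (N / R) / 5) := by
          rw [← Real.exp_nat_mul, ← Real.exp_add]
          congr 1
          push_cast
          field_simp
          ring
      _ ≤ Real.exp (Real.log δ) := by
          refine Real.exp_le_exp.2 ?_
          have h5 : 1 ≤ l * R := one_le_mul_of_one_le_of_one_le hl1 hR1
          have h6 : (p : ℝ) ≤ p * (l * R) := le_mul_of_one_le_right (by positivity) h5
          have h7 : ℓ ≤ p * (l * R) * ℓ := le_mul_of_one_le_left hℓ0.le (hp1.trans h6)
          have h8 : (0 : ℝ) ≤ l * R * ℓ := by positivity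
          have h9 : (0 : ℝ) ≤ p * (l * R * ℓ) := by positivity
          linarith
      _ = δ := Real.exp_log hδ

/-- Here `R = 1 / ρ`. The first sample size condition serves to get `R ≤ N`, hence `1 ≤ l`; squaring
the second produces the constant `2048 = 2 * 32 ^ 2`. -/
lemma exists_grid_size_of_ml_sample_size {p N K : ℕ} (hp : 1 ≤ p) (hK : 1 ≤ K) {δ c₀ ρ : ℝ}
    (hδ : 0 < δ) (hδ1 : δ < 1) (hc₀ : 0 < c₀) (hc₁ : c₀ < 1)
    (hρ : ρ = 1 / (K : ℝ) ^ (1 + 1 / (2 * (p : ℝ))))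
    (hN : 2 * ((1 - c₀) ^ 2)⁻¹ * (K : ℝ) ^ (1 + 1 / (2 * (p : ℝ))) * Real.log (2 * K / δ) < N)
    (hN' : 32 * c₀⁻¹ * √(2 * (p + 1)) * (K : ℝ) ^ (3 / 2 + 1 / (2 * (p : ℝ))) *
        √(Real.log (3 * Real.exp 1 * N / K) * Real.log (8 / δ)) ≤ √(N : ℝ)) :
    ∃ M : ℕ, 1 ≤ M ∧ 10 * Fintype.card (Fin p × Bool) ≤ 2 * ρ * M ∧
      (M + 1) ^ Fintype.card (Fin p × Bool) * Real.exp (-(2 * ρ * N / 10)) ≤ δ := by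
  have hp1 : (1 : ℝ) ≤ p := by exact_mod_cast hp
  have hK1 : (1 : ℝ) ≤ K := by exact_mod_cast hK
  set R : ℝ := (K : ℝ) ^ (1 + 1 / (2 * (p : ℝ))) with hR
  have hKR : (K : ℝ) ≤ R := by
    calc (K : ℝ) = (K : ℝ) ^ (1 : ℝ) := (Real.rpow_one _).symm
      _ ≤ R := Real.rpow_le_rpow_of_exponent_le hK1 (by simp)
  have hR1 : 1 ≤ R := hK1.trans hKR
  have hS : R ≤ (K : ℝ) ^ (3 / 2 + 1 / (2 * (p : ℝ))) :=
    Real.rpow_le_rpow_of_exponent_le hK1 (by linarith)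
  have hlog2 := Real.log_two_gt_d9
  have hlog2K : 0.69 ≤ Real.log (2 * K / δ) := by
    have : Real.log 2 ≤ Real.log (2 * K / δ) := by
      refine Real.log_le_log (by norm_num) ?_
      rw [le_div_iff₀ hδ]
      nlinarith
    linarith
  have hinv : 1 ≤ ((1 - c₀) ^ 2)⁻¹ := by
    refine (one_le_inv₀ (by nlinarith)).2 ?_
    nlinarith
  have hNR : R ≤ N := by
    refine le_trans ?_ hN.le
    have h1 : R ≤ 2 * 1 * R * 0.69 := by linarith
    refine h1.trans ?_
    gcongr
  have hNK : (K : ℝ) ≤ N := hKR.trans hNR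
  have hN0 : (0 : ℝ) < N := by linarith
  set ℓ := -Real.log δ with hℓ
  have hℓ0 : 0 < ℓ := neg_pos.2 (Real.log_neg hδ hδ1)
  have hlog8 : 2 + ℓ ≤ Real.log (8 / δ) := by
    rw [Real.log_div (by norm_num) hδ.ne', show (8 : ℝ) = 2 ^ 3 by norm_num, Real.log_pow]
    push_cast
    linarith
  set l := Real.log (3 * Real.exp 1 * N / K) with hl
  have hl1 : 1 ≤ l := by
    rw [hl, Real.le_log_iff_exp_le (by positivity), le_div_iff₀ (by positivity)]
    nlinarith [Real.exp_pos 1]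
  have hNbig : 2048 * (p + 1) * R ^ 2 * (l * (2 + ℓ)) ≤ N := by
    have h1 : 32 * √(2 * (p + 1)) * R * √(l * (2 + ℓ)) ≤ √(N : ℝ) := by
      refine le_trans ?_ hN'
      have h2 : 1 ≤ c₀⁻¹ := (one_le_inv₀ hc₀).2 hc₁.le
      have h3 : (32 : ℝ) ≤ 32 * c₀⁻¹ := by linarith
      gcongr
    have h2 := pow_le_pow_left₀ (by positivity) h1 2
    rw [Real.sq_sqrt (Nat.cast_nonneg _), mul_pow, mul_pow, mul_pow, Real.sq_sqrt (by positivity),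
      Real.sq_sqrt (by positivity)] at h2
    linarith
  have hlp : Real.log (12 * p) ≤ l := by
    refine Real.log_le_log (by positivity) ?_
    rw [le_div_iff₀ (by positivity)]
    have h1 : (2 : ℝ) ≤ l * (2 + ℓ) := by nlinarith
    have h2 : (K : ℝ) ≤ R ^ 2 := by nlinarith
    have h3 : 2048 * (p + 1) * K * 2 ≤ (N : ℝ) := by
      refine le_trans ?_ hNbig
      gcongr
    have h4 : (1 : ℝ) ≤ Real.exp 1 := Real.one_le_exp (by norm_num)
    have h5 : (N : ℝ) ≤ Real.exp 1 * N := le_mul_of_one_le_left (by positivity) h4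
    have h6 : (0 : ℝ) ≤ p * K := by positivity
    nlinarith
  obtain ⟨M, hM⟩ := exists_grid_size hp hR1 hl1 hδ hδ1 hlp hNbig
  rw [hρ, one_div]
  exact ⟨M, hM⟩

/-- The second bound is the union bound over at most `3K` nodes and their covers. With `l = log K`
and `t = log (K / δ)`, the depth is at most `3l` and the grid size at most `exp (7l)`, so the covers
cost `21 l²` in the exponent, against a gain of `N / (25K) ≥ (944 / 25) l² t`. -/
lemma median_sample_size_le {N K : ℕ} (hK : 2 ≤ K) {δ : ℝ} (hδ : 0 < δ) (hδ1 : δ < 1)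
    (hN : 128 * Real.exp 1 ^ 2 * K * Real.log K ^ 2 * Real.log (K / δ) < N) :
    20 * (K : ℝ) ≤ N ∧
    (3 * K) * (((25 * (Nat.log 2 K + 1) * K : ℕ) + 1 : ℝ) ^ (Nat.log 2 K + 1) *
      Real.exp (-(2 / (5 * K) * N / 10))) ≤ δ := by
  have hK2 : (2 : ℝ) ≤ K := by exact_mod_cast hK
  have hK0 : (0 : ℝ) < K := by linarith
  set l := Real.log K with hl
  have hlog2 := Real.log_two_gt_d9
  have hlog2' := Real.log_two_lt_d9
  have hl2 : Real.log 2 ≤ l := Real.log_le_log (by norm_num) hK2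
  have hl1 : 0.693 ≤ l := by linarith
  set t := Real.log (K / δ) with ht
  have htl : t = l - Real.log δ := Real.log_div hK0.ne' hδ.ne'
  have hlt : l ≤ t := by
    have := Real.log_neg hδ hδ1
    linarith
  have hsq : 0.48 ≤ l ^ 2 := by nlinarith
  have hexp : 7.38 ≤ Real.exp 1 ^ 2 := by
    have := Real.exp_one_gt_d9
    nlinarith
  have hNK : 944 * (l ^ 2 * t) ≤ N / K := by
    rw [le_div_iff₀ hK0]
    refine le_trans ?_ hN.le
    have h1 : 128 * 7.38 * K * l ^ 2 * t ≤ 128 * Real.exp 1 ^ 2 * K * l ^ 2 * t := by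
      have : 0 ≤ t := by linarith
      gcongr
    have h2 : 0 ≤ K * l ^ 2 * t := by
      have : 0 ≤ t := by linarith
      positivity
    nlinarith
  have hlt3 : 0.48 * t ≤ l ^ 2 * t := mul_le_mul_of_nonneg_right hsq (by linarith)
  constructor
  · rw [← le_div_iff₀ hK0]
    linarith
  · have hd : ((Nat.log 2 K : ℕ) : ℝ) * Real.log 2 ≤ l := by
      rw [← Real.log_pow]
      refine Real.log_le_log (by positivity) ?_
      exact_mod_cast Nat.pow_log_le_self 2 (by omega)
    have hr : ((Nat.log 2 K + 1 : ℕ) : ℝ) ≤ 3 * l := by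
      push_cast
      nlinarith [(Nat.cast_nonneg (Nat.log 2 K) : (0 : ℝ) ≤ _)]
    have hrK : Nat.log 2 K + 1 ≤ K := Nat.log_lt_self 2 (by omega)
    have hbase : ((25 * (Nat.log 2 K + 1) * K : ℕ) + 1 : ℝ) ≤ Real.exp (7 * l) := by
      have h1 : ((Nat.log 2 K + 1 : ℕ) : ℝ) ≤ K := by exact_mod_cast hrK
      calc ((25 * (Nat.log 2 K + 1) * K : ℕ) + 1 : ℝ)
          = 25 * (Nat.log 2 K + 1 : ℕ) * K + 1 := by push_cast; ring
        _ ≤ 25 * K * K + 1 := by gcongr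
        _ ≤ 2 ^ 5 * K ^ 2 := by nlinarith
        _ ≤ (K : ℝ) ^ 5 * K ^ 2 := by gcongr
        _ = Real.exp (7 * l) := by
          rw [show (7 : ℝ) * l = (7 : ℕ) * l by norm_num, Real.exp_nat_mul, hl, Real.exp_log hK0,
            ← pow_add]
    have h3 : (3 : ℝ) * K ≤ Real.exp (1.387 + l) := by
      rw [Real.exp_add, Real.exp_log hK0]
      gcongr
      refine (Real.log_le_iff_le_exp (by norm_num)).1 ?_
      calc Real.log 3 ≤ Real.log (2 ^ 2) := Real.log_le_log (by norm_num) (by norm_num)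
        _ ≤ 1.387 := by rw [Real.log_pow]; push_cast; linarith
    calc (3 * K) * (((25 * (Nat.log 2 K + 1) * K : ℕ) + 1 : ℝ) ^ (Nat.log 2 K + 1) *
          Real.exp (-(2 / (5 * K) * N / 10)))
        ≤ Real.exp (1.387 + l) * (Real.exp (7 * l) ^ (Nat.log 2 K + 1) *
          Real.exp (-(2 / (5 * K) * N / 10))) := by gcongr
      _ = Real.exp (1.387 + l + (Nat.log 2 K + 1 : ℕ) * (7 * l) - N / K / 25) := by
          rw [← Real.exp_nat_mul, ← Real.exp_add, ← Real.exp_add]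
          congr 1
          field_simp
          ring
      _ ≤ Real.exp (Real.log δ) := by
          refine Real.exp_le_exp.2 ?_
          have h4 : ((Nat.log 2 K + 1 : ℕ) : ℝ) * (7 * l) ≤ 3 * l * (7 * l) := by gcongr
          have h5 : 0.693 * l ^ 2 ≤ l ^ 2 * t := by nlinarith
          nlinarith
      _ = δ := Real.exp_log hδ

/-! ### Good events -/

lemma IsDensity.isProbabilityMeasure_law {p : ℕ} {g : (Fin p → ℝ) → ℝ} (hg : IsDensity g) :
    IsProbabilityMeasure (law g) := by
  refine ⟨?_⟩
  rw [law, withDensity_apply _ MeasurableSet.univ, Measure.restrict_univ,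
    ← ofReal_integral_eq_lintegral_ofReal hg.integrableOn
      (ae_restrict_of_forall_mem (measurableSet_cube p) hg.nonneg), hg.integral_eq_one,
    ENNReal.ofReal_one]

lemma ofReal_one_sub_le_measure_iInter {Ω : Type*} [MeasurableSpace Ω] {μ : Measure Ω}
    [IsProbabilityMeasure μ] {m : ℕ} {E : Fin m → Set Ω} {E₀ : Set Ω} (hE₀ : MeasurableSet E₀)
    (hE : ∀ i, MeasurableSet (E i)) {δ : ℝ} (h₀ : μ E₀ᶜ = 0) (h : ∀ i, μ.real (E i)ᶜ ≤ δ) :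
    ENNReal.ofReal (1 - m * δ) ≤ μ (E₀ ∩ ⋂ i, E i) := by
  have hmeas : MeasurableSet (E₀ ∩ ⋂ i, E i) := hE₀.inter (MeasurableSet.iInter hE)
  rw [← ofReal_measureReal]
  refine ENNReal.ofReal_le_ofReal ?_
  have h1 : μ.real (E₀ ∩ ⋂ i, E i)ᶜ ≤ m * δ := by
    rw [Set.compl_inter, Set.compl_iInter]
    calc μ.real (E₀ᶜ ∪ ⋃ i, (E i)ᶜ) ≤ μ.real E₀ᶜ + ∑ i, μ.real (E i)ᶜ :=
          (measureReal_union_le _ _).trans (by gcongr; exact measureReal_iUnion_fintype_le _)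
      _ ≤ 0 + ∑ _i : Fin m, δ := by
          gcongr with i
          · simp [measureReal_def, h₀]
          · exact h i
      _ = m * δ := by simp
  have h2 := probReal_add_probReal_compl (μ := μ) hmeas
  linarith

/-- Independent variables without atoms are almost surely different. -/
lemma measure_setOf_eq_of_indepFun {Ω : Type*} [MeasurableSpace Ω] {μ : Measure Ω}
    [IsProbabilityMeasure μ] {U V : Ω → ℝ} (hU : Measurable U) (hV : Measurable V)
    (hUV : IndepFun U V μ) (h0 : ∀ t, μ.map V {t} = 0) : μ {ω | U ω = V ω} = 0 := by
  have hdiag : MeasurableSet {z : ℝ × ℝ | z.1 = z.2} := measurableSet_eq_fun measurable_fst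
    measurable_snd
  have := Measure.isProbabilityMeasure_map (μ := μ) hV.aemeasurable
  have h := (indepFun_iff_map_prod_eq_prod_map_map hU.aemeasurable hV.aemeasurable).1 hUV
  have h1 : μ {ω | U ω = V ω} = μ.map (fun ω => (U ω, V ω)) {z : ℝ × ℝ | z.1 = z.2} := by
    rw [Measure.map_apply (hU.prodMk hV) hdiag]
    rfl
  -- By Fubini the diagonal is null, since its slices are points.
  rw [h1, h, Measure.measure_prod_null hdiag]
  refine .of_forall fun u => ?_
  have : Prod.mk u ⁻¹' {z : ℝ × ℝ | z.1 = z.2} = {u} := by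
    ext v
    simp [eq_comm]
  simp only [this, h0, Pi.zero_apply]

/-- Almost surely, all sample points lie in the half-open cube, and no two of them agree in a
coordinate. -/
lemma exists_generic_event {Ω : Type*} [MeasurableSpace Ω] {μ : Measure Ω}
    [IsProbabilityMeasure μ] {p : ℕ} {ι : Type*} [Countable ι] {g : ι → (Fin p → ℝ) → ℝ}
    {Y : ι → Ω → Fin p → ℝ} (hY : ∀ j, Measurable (Y j)) (hlaw : ∀ j, μ.map (Y j) = law (g j))
    (hindep : iIndepFun Y μ) :
    ∃ E : Set Ω, MeasurableSet E ∧ μ Eᶜ = 0 ∧ ∀ ω ∈ E,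
      (∀ j, Y j ω ∈ (unitBox p : Set (Fin p → ℝ))) ∧
      ∀ q, Function.Injective fun j => Y j ω q := by
  have hae : ∀ᵐ ω ∂μ, (∀ j, Y j ω ∈ (unitBox p : Set (Fin p → ℝ))) ∧
      ∀ q, Function.Injective fun j => Y j ω q := by
    refine (ae_all_iff.2 fun j => ?_).and (ae_all_iff.2 fun q => ?_)
    · have h := law_compl_unitBox (g j)
      rw [← hlaw j, Measure.map_apply (hY j) (unitBox p).measurableSet_coe.compl] at h
      exact h
    · have h : ∀ᵐ ω ∂μ, ∀ i j, i ≠ j → Y i ω q ≠ Y j ω q := by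
        refine ae_all_iff.2 fun i => ae_all_iff.2 fun j => ?_
        by_cases hij : i = j
        · exact .of_forall fun ω h => absurd hij h
        · have hq : ∀ j, Measurable fun ω => Y j ω q := fun j =>
            (measurable_pi_apply q).comp (hY j)
          have hind : IndepFun (fun ω => Y i ω q) (fun ω => Y j ω q) μ :=
            (hindep.indepFun hij).comp (measurable_pi_apply q) (measurable_pi_apply q)
          have h0 : ∀ t, μ.map (fun ω => Y j ω q) {t} = 0 := by
            intro t
            have h := law_hyperplane (g j) q t
            have ht : MeasurableSet {x : Fin p → ℝ | x q = t} :=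
              measurableSet_eq_fun (measurable_pi_apply q) measurable_const
            rw [← hlaw j, Measure.map_apply (hY j) ht] at h
            rw [Measure.map_apply (hq j) (measurableSet_singleton t)]
            exact h
          have := measure_setOf_eq_of_indepFun (hq i) (hq j) hind h0
          filter_upwards [measure_eq_zero_iff_ae_notMem.1 this] with ω hω _ using hω
      filter_upwards [h] with ω hω i j hij
      by_contra hne
      exact hω i j hne hij
  obtain ⟨t, hsub, ht, hμ⟩ := exists_measurable_superset_of_null hae
  exact ⟨tᶜ, ht.compl, by rwa [compl_compl], fun ω hω => by_contra fun h => hω (hsub h)⟩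

/-! ### Counts in blocks -/

lemma countIn_inter_of_forall_mem {ι β : Type*} [Fintype ι] {x : ι → β} {U : Set β}
    (hx : ∀ j, x j ∈ U) (s : Set β) : countIn x (U ∩ s) = countIn x s := by
  unfold countIn
  congr 1
  ext j
  simp [hx]

/-- The uniform bound for the regions of a pattern, in terms of the areas of blocks. -/
lemma count_le_of_region {p N : ℕ} {g : (Fin p → ℝ) → ℝ} {D : ℝ} (hD : 0 ≤ D)
    (hg : ∀ θ ∈ cube p, g θ ≤ D) {x : Fin N → Fin p → ℝ}
    (hx : ∀ j, x j ∈ (unitBox p : Set (Fin p → ℝ))) {C : BoxIntegral.Box (Fin p)}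
    {s : Set (Fin p → ℝ)} (hC : (C : Set (Fin p → ℝ)) = (unitBox p : Set (Fin p → ℝ)) ∩ s)
    (h : (countIn x s : ℝ) ≤ 2 * (N * (law g).real s)) :
    (count x C : ℝ) ≤ 2 * D * (N * area C) := by
  -- The region `s` may leave the unit box, but neither the law nor the sample charges the part
  -- outside.
  have hlaw : (law g).real s = (law g).real C := by
    rw [measureReal_def, measureReal_def, hC, Set.inter_comm,
      measure_inter_conull (law_compl_unitBox g)]
  rw [count_eq_countIn, hC, countIn_inter_of_forall_mem hx]
  refine h.trans ?_
  rw [hlaw]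
  calc 2 * (N * (law g).real C) ≤ 2 * (N * (D * area C)) := by
        gcongr
        exact law_real_le hD hg C
    _ = 2 * D * (N * area C) := by ring

lemma count_prod {p m N : ℕ} (x : Fin m → Fin N → Fin p → ℝ) (C : BoxIntegral.Box (Fin p)) :
    (count (fun ij : Fin m × Fin N => x ij.1 ij.2) C : ℝ) = ∑ i, (count (x i) C : ℝ) := by
  simp_rw [count_eq_countIn, countIn_eq_sum, Fintype.sum_prod_type]

lemma count_le_card {p : ℕ} {ι : Type*} [Fintype ι] (x : ι → Fin p → ℝ)
    (C : BoxIntegral.Box (Fin p)) : count x C ≤ Fintype.card ι :=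
  Finset.card_le_univ _

lemma count_unitBox {p : ℕ} {ι : Type*} [Fintype ι] {x : ι → Fin p → ℝ}
    (hx : ∀ j, x j ∈ (unitBox p : Set (Fin p → ℝ))) : count x (unitBox p) = Fintype.card ι := by
  rw [count_eq_countIn, countIn]
  simp only [hx, Finset.filter_true, Finset.card_univ]

/-- The block, the path and the number of sample points of a leaf of a median partition. -/
lemma IsKDPartition.exists_path {p K : ℕ} {ι : Type*} [Fintype ι] {x : ι → Fin p → ℝ}
    {dir : List Bool → Fin p} {A : BoxIntegral.Prepartition (unitBox p)} (hK : 1 ≤ K)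
    (h : IsKDPartition x dir K A) (hxU : ∀ j, x j ∈ (unitBox p : Set (Fin p → ℝ)))
    (hx : ∀ q, Function.Injective fun j => x j q) {C : BoxIntegral.Box (Fin p)} (hC : C ∈ A) :
    ∃ a : List Bool, (a.length = Nat.log 2 K ∨ a.length = Nat.log 2 K + 1) ∧
      (∃ c : Fin a.length → ℝ, (C : Set (Fin p → ℝ)) =
        (unitBox p : Set (Fin p → ℝ)) ∩ region (pathPattern dir a) c) ∧
      (Fintype.card ι : ℝ) ≤ 2 * K * (count x C + 2) := by
  have hroot : region (pathPattern dir []) (Fin.elim0 : Fin ([] : List Bool).length → ℝ) =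
      Set.univ := Set.eq_univ_of_forall fun y k => Fin.elim0 k
  obtain ⟨a, ha, hc, hn⟩ := h.1.leaf_region hx (unitBox p : Set (Fin p → ℝ)) (Fintype.card ι)
    (by simp) Fin.elim0 (by rw [hroot, Set.inter_univ]) (by simp [count_unitBox hxU]) C hC
  refine ⟨a, ha, hc, ?_⟩
  have h1 : 2 ^ a.length ≤ 2 * K := by
    calc 2 ^ a.length ≤ 2 ^ (Nat.log 2 K + 1) := Nat.pow_le_pow_right (by norm_num) (by omega)
      _ ≤ 2 * K := by
        rw [pow_succ, mul_comm]
        exact Nat.mul_le_mul_left 2 (Nat.pow_log_le_self 2 (by omega))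
  have h2 : Fintype.card ι ≤ 2 * K * (count x C + 2) := by
    have := Nat.mul_le_mul_right (count x C + 2) h1
    omega
  exact_mod_cast h2

/-- The addresses of the nodes of depth `n`. -/
def nodes (n : ℕ) : Finset (List Bool) :=
  Finset.univ.image (List.ofFn : (Fin n → Bool) → List Bool)

lemma mem_nodes {n : ℕ} {a : List Bool} : a ∈ nodes n ↔ a.length = n := by
  constructor
  · intro h
    obtain ⟨v, -, rfl⟩ := Finset.mem_image.1 h
    exact List.length_ofFn
  · rintro rfl
    exact Finset.mem_image.2 ⟨a.get, Finset.mem_univ _, List.ofFn_get a⟩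

lemma card_nodes_le (n : ℕ) : (nodes n).card ≤ 2 ^ n := by
  refine Finset.card_image_le.trans ?_
  simp

/-! ### The two kinds of partitions -/

lemma iIndepFun_sample {Ω β : Type*} [MeasurableSpace Ω] [MeasurableSpace β] {μ : Measure Ω}
    {m N : ℕ} {X : Fin m → Fin N → Ω → β}
    (hindep : iIndepFun (fun ij : Fin m × Fin N => X ij.1 ij.2) μ) (i : Fin m) :
    iIndepFun (X i) μ :=
  hindep.precomp (g := fun j => (i, j)) fun _ _ h => (Prod.ext_iff.1 h).2

section

variable {Ω : Type*} [MeasurableSpace Ω] {μ : Measure Ω} [IsProbabilityMeasure μ] {p m N K : ℕ}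
  {f : Fin m → (Fin p → ℝ) → ℝ} {X : Fin m → Fin N → Ω → Fin p → ℝ} {δ : ℝ}

/-- With probability at least `1 - m δ`, every block `C` of area at least `ρ / D` has a density
estimate of at most `2 D` in each sample. -/
lemma exists_ml_event (hp : 1 ≤ p) (hK : 1 ≤ K) (hf : ∀ i, IsDensity (f i))
    (hX : ∀ i j, Measurable (X i j)) (hlaw : ∀ i j, μ.map (X i j) = law (f i))
    (hindep : iIndepFun (fun ij : Fin m × Fin N => X ij.1 ij.2) μ)
    (hδ : 0 < δ) (hδ1 : δ < 1) {c₀ ρ : ℝ} (hc₀ : 0 < c₀) (hc₁ : c₀ < 1)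
    (hρ : ρ = 1 / (K : ℝ) ^ (1 + 1 / (2 * (p : ℝ))))
    (hN : 2 * ((1 - c₀) ^ 2)⁻¹ * (K : ℝ) ^ (1 + 1 / (2 * (p : ℝ))) * Real.log (2 * K / δ) < N)
    (hN' : 32 * c₀⁻¹ * √(2 * (p + 1)) * (K : ℝ) ^ (3 / 2 + 1 / (2 * (p : ℝ))) *
        √(Real.log (3 * Real.exp 1 * N / K) * Real.log (8 / δ)) ≤ √(N : ℝ)) :
    ∃ E : Set Ω, MeasurableSet E ∧ ENNReal.ofReal (1 - m * δ) ≤ μ E ∧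
      ∀ ω ∈ E, ∀ i, ∀ D : ℝ, supNorm (f i) ≤ D → ∀ C : BoxIntegral.Box (Fin p),
        (C : Set (Fin p → ℝ)) ⊆ unitBox p → ρ / D ≤ area C →
        (count (fun j => X i j ω) C : ℝ) ≤ 2 * D * (N * area C) := by
  obtain ⟨M, hM, hcard, hμ⟩ := exists_grid_size_of_ml_sample_size hp hK hδ hδ1 hc₀ hc₁ hρ hN hN'
  have hG : ∀ i, ∃ G : Set (Fin N → Fin p → ℝ), MeasurableSet G ∧
      μ.real ((fun ω j => X i j ω) ⁻¹' Gᶜ) ≤ δ ∧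
      ∀ x ∈ G, ∀ c, 2 * ρ * N ≤ countIn x (region (id : Fin p × Bool → Fin p × Bool) c) →
        (countIn x (region id c) : ℝ) ≤ 2 * (N * (law (f i)).real (region id c)) := by
    intro i
    have := (hf i).isProbabilityMeasure_law
    obtain ⟨G, hGm, hGμ, hG⟩ := exists_uniform_countIn_region_le (hX i)
      (iIndepFun_sample hindep i) (hlaw i) (law_hyperplane (f i))
      (id : Fin p × Bool → Fin p × Bool) hM hcard
    exact ⟨G, hGm, hGμ.trans hμ, hG⟩
  choose G hGm hGμ hG using hG
  obtain ⟨E₀, hE₀m, hE₀μ, hE₀⟩ := exists_generic_event (ι := Fin m × Fin N)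
    (μ := μ) (p := p) (Y := fun ij : Fin m × Fin N => X ij.1 ij.2) (g := fun ij => f ij.1)
    (fun ij => hX ij.1 ij.2) (fun ij => hlaw ij.1 ij.2) hindep
  have hE : ∀ i, MeasurableSet ((fun ω j => X i j ω) ⁻¹' G i) := fun i =>
    measurable_pi_lambda (fun ω j => X i j ω) (hX i) (hGm i)
  refine ⟨_, hE₀m.inter (MeasurableSet.iInter hE), ofReal_one_sub_le_measure_iInter hE₀m hE hE₀μ
    hGμ, fun ω hω i D hD C hCU hCρ => ?_⟩
  have hD0 : 0 < D := by linarith [(hf i).one_le_supNorm]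
  have hinter : (C : Set (Fin p → ℝ)) = (unitBox p : Set (Fin p → ℝ)) ∩
      region id (fun k => if k.2 then C.lower k.1 else C.upper k.1) := by
    rw [← coe_box_eq_region, Set.inter_eq_right.2 hCU]
  have hxU : ∀ j, X i j ω ∈ (unitBox p : Set (Fin p → ℝ)) := fun j => (hE₀ ω hω.1).1 (i, j)
  -- Well-filled boxes are covered by the uniform bound with `α = 2ρ`; for the others `ρ ≤ D * area
  -- C` suffices.
  by_cases hbig : 2 * ρ * N ≤ count (fun j => X i j ω) C
  · refine count_le_of_region hD0.le
      (fun θ hθ => (le_supNorm (hf i).continuousOn hθ).trans hD) hxU hinter ?_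
    refine hG i _ (Set.mem_iInter.1 hω.2 i) _ ?_
    rwa [← coe_box_eq_region, ← count_eq_countIn]
  · rw [div_le_iff₀ hD0] at hCρ
    calc (count (fun j => X i j ω) C : ℝ) ≤ 2 * ρ * N := (not_le.1 hbig).le
      _ ≤ 2 * (area C * D) * N := by gcongr
      _ = 2 * D * (N * area C) := by ring

/-- With probability at least `1 - m δ`, the sample points are generic, and every node of depth
`⌊log₂ K⌋` or `⌊log₂ K⌋ + 1` that holds a fraction of at least `2 / (5 K)` of a sample has a density
estimate of at most `2 D` in this sample. -/
lemma exists_kd_event (hK : 2 ≤ K) (hf : ∀ i, IsDensity (f i))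
    (hX : ∀ i j, Measurable (X i j)) (hlaw : ∀ i j, μ.map (X i j) = law (f i))
    (hindep : iIndepFun (fun ij : Fin m × Fin N => X ij.1 ij.2) μ)
    (hδ : 0 < δ) (hδ1 : δ < 1)
    (hN : 128 * Real.exp 1 ^ 2 * K * Real.log K ^ 2 * Real.log (K / δ) < N)
    {dir : Fin m → Ω → List Bool → Fin p} (hdir : ∀ i, Measurable (dir i))
    (hdirX : ∀ i, IndepFun (dir i) (fun ω j => X i j ω) μ) :
    ∃ E : Set Ω, MeasurableSet E ∧ ENNReal.ofReal (1 - m * δ) ≤ μ E ∧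
      ∀ ω ∈ E, (∀ ij : Fin m × Fin N, X ij.1 ij.2 ω ∈ (unitBox p : Set (Fin p → ℝ))) ∧
        (∀ q, Function.Injective fun ij : Fin m × Fin N => X ij.1 ij.2 ω q) ∧
        ∀ i, ∀ a : List Bool, (a.length = Nat.log 2 K ∨ a.length = Nat.log 2 K + 1) →
          ∀ C : BoxIntegral.Box (Fin p), (∃ c : Fin a.length → ℝ, (C : Set (Fin p → ℝ)) =
            (unitBox p : Set (Fin p → ℝ)) ∩ region (pathPattern (dir i ω) a) c) →
          2 / (5 * K) * N ≤ (count (fun j => X i j ω) C : ℝ) →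
          (count (fun j => X i j ω) C : ℝ) ≤ 2 * maxSup f * (N * area C) := by
  classical
  obtain ⟨-, hμ⟩ := median_sample_size_le hK hδ hδ1 hN
  have hK0 : (0 : ℝ) < K := by positivity
  set d := Nat.log 2 K with hd
  set 𝒜 := nodes d ∪ nodes (d + 1) with h𝒜
  have h𝒜mem : ∀ a, a ∈ 𝒜 ↔ a.length = d ∨ a.length = d + 1 := fun a => by
    rw [h𝒜, Finset.mem_union, mem_nodes, mem_nodes]
  have h𝒜card : (𝒜.card : ℝ) ≤ 3 * K := by
    have h1 : 2 ^ d ≤ K := Nat.pow_log_le_self 2 (by omega)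
    have h2 : 𝒜.card ≤ 3 * K := by
      calc 𝒜.card ≤ 2 ^ d + 2 ^ (d + 1) :=
            (Finset.card_union_le _ _).trans (add_le_add (card_nodes_le _) (card_nodes_le _))
        _ = 3 * 2 ^ d := by rw [pow_succ]; ring
        _ ≤ 3 * K := Nat.mul_le_mul_left 3 h1
    exact_mod_cast h2
  have hE : ∀ i, ∃ E : Set Ω, MeasurableSet E ∧ μ.real Eᶜ ≤ δ ∧
      ∀ ω ∈ E, ∀ a ∈ 𝒜, ∀ c,
        2 / (5 * K) * N ≤
          (countIn (fun j => X i j ω) (region (pathPattern (dir i ω) a) c) : ℝ) →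
        (countIn (fun j => X i j ω) (region (pathPattern (dir i ω) a) c) : ℝ) ≤
          2 * (N * (law (f i)).real (region (pathPattern (dir i ω) a) c)) := by
    intro i
    have := (hf i).isProbabilityMeasure_law
    obtain ⟨E, hEm, hEμ, hE⟩ := exists_uniform_countIn_path_le (hX i)
      (iIndepFun_sample hindep i) (hlaw i) (law_hyperplane (f i)) (hdir i) (hdirX i) 𝒜
      -- `M` is chosen so that `10 * r = α * M` exactly.
      (r := d + 1) (M := 25 * (d + 1) * K) (α := 2 / (5 * K))
      (fun a ha => by rcases (h𝒜mem a).1 ha with h | h <;> omega)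
      (Nat.mul_pos (by omega) (by omega))
      (le_of_eq (by push_cast; field_simp; ring))
    refine ⟨E, hEm, hEμ.trans (le_trans ?_ hμ), hE⟩
    gcongr
  choose E hEm hEμ hE using hE
  obtain ⟨E₀, hE₀m, hE₀μ, hE₀⟩ := exists_generic_event (ι := Fin m × Fin N)
    (μ := μ) (p := p) (Y := fun ij : Fin m × Fin N => X ij.1 ij.2) (g := fun ij => f ij.1)
    (fun ij => hX ij.1 ij.2) (fun ij => hlaw ij.1 ij.2) hindep
  refine ⟨_, hE₀m.inter (MeasurableSet.iInter hEm), ofReal_one_sub_le_measure_iInter hE₀m hEm hE₀μ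
    hEμ, fun ω hω => ⟨(hE₀ ω hω.1).1, (hE₀ ω hω.1).2, ?_⟩⟩
  rintro i a ha C ⟨c, hc⟩ hbig
  have hxU : ∀ j, X i j ω ∈ (unitBox p : Set (Fin p → ℝ)) := fun j => (hE₀ ω hω.1).1 (i, j)
  refine count_le_of_region (by linarith [one_le_maxSup hf i]) (fun θ hθ => le_maxSup hf i hθ)
    hxU hc (hE i ω (Set.mem_iInter.1 hω.2 i) a ((h𝒜mem a).2 ha) c ?_)
  rwa [count_eq_countIn, hc, countIn_inter_of_forall_mem hxU] at hbig

lemma aggregationBound_hist (hm : 1 ≤ m) (hf : ∀ i, IsDensity (f i)) (hZ : 0 < Z f Finset.univ)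
    {x : Fin m → Fin N → Fin p → ℝ} {A : Fin m → BoxIntegral.Prepartition (unitBox p)}
    (h : ∀ i, ∀ C ∈ A i, (count (x i) C : ℝ) ≤ 2 * maxSup f * (N * area C)) :
    AggregationBound f fun i => hist (x i) (A i) := by
  have hD := one_le_maxSup hf ⟨0, hm⟩
  exact aggregationBound_of_le hm hf hZ (fun i => measurable_hist _ _)
    (fun i => hist_nonneg _ _) fun i => hist_le (by linarith) (h i)

/-- For `K = 1` the sample size conditions degenerate, as `log K = 0`, but the only block is the
unit box and no concentration is needed. -/
lemma count_le_of_isKDPartition_one (hf : ∀ i, IsDensity (f i)) {i : Fin m} {ι : Type*}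
    [Fintype ι] {y : ι → Fin p → ℝ} {dir : List Bool → Fin p} {x : Fin N → Fin p → ℝ}
    {A : BoxIntegral.Prepartition (unitBox p)} (h : IsKDPartition y dir 1 A)
    {C : BoxIntegral.Box (Fin p)} (hC : C ∈ A) :
    (count x C : ℝ) ≤ 2 * maxSup f * (N * area C) := by
  have hC' : C ∈ A.boxes := hC
  rw [h.1.eq_singleton_of_card_eq_one h.2, Finset.mem_singleton] at hC'
  have h1 : (count x C : ℝ) ≤ N := by exact_mod_cast (count_le_card x C).trans_eq (by simp)
  have h2 := one_le_maxSup hf i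
  rw [hC', area_unitBox, mul_one]
  rw [hC'] at h1
  nlinarith [(Nat.cast_nonneg N : (0 : ℝ) ≤ N)]

/-- Median partitions of the separate samples. -/
lemma kd_separate (hm : 1 ≤ m) (hK : 1 ≤ K) (hf : ∀ i, IsDensity (f i))
    (hZ : 0 < Z f Finset.univ) (hX : ∀ i j, Measurable (X i j))
    (hlaw : ∀ i j, μ.map (X i j) = law (f i))
    (hindep : iIndepFun (fun ij : Fin m × Fin N => X ij.1 ij.2) μ)
    (hδ : 0 < δ) (hδ1 : δ < 1)
    (hN : 128 * Real.exp 1 ^ 2 * K * Real.log K ^ 2 * Real.log (K / δ) < N)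
    {dir : Ω → Fin m → List Bool → Fin p} (hdir : Measurable dir)
    (hdirX : IndepFun dir (fun ω (ij : Fin m × Fin N) => X ij.1 ij.2 ω) μ) :
    ∃ E : Set Ω, MeasurableSet E ∧ ENNReal.ofReal (1 - m * δ) ≤ μ E ∧
      ∀ ω ∈ E, ∀ A : Fin m → BoxIntegral.Prepartition (unitBox p),
        (∀ i, IsKDPartition (fun j => X i j ω) (dir ω i) K (A i)) →
        AggregationBound f fun i => hist (fun j => X i j ω) (A i) := by
  rcases hK.eq_or_lt with rfl | hK
  · refine ⟨Set.univ, MeasurableSet.univ, ?_, fun ω _ A hA => ?_⟩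
    · rw [measure_univ, ← ENNReal.ofReal_one]
      exact ENNReal.ofReal_le_ofReal (by linarith [show 0 ≤ m * δ by positivity])
    · exact aggregationBound_hist hm hf hZ fun i C hC =>
        count_le_of_isKDPartition_one hf (i := i) (hA i) hC
  · obtain ⟨E, hEm, hEμ, hE⟩ := exists_kd_event hK hf hX hlaw hindep hδ hδ1 hN
      (dir := fun i ω => dir ω i) (fun i => (measurable_pi_apply i).comp hdir) fun i =>
      hdirX.comp (measurable_pi_apply i)
        (measurable_pi_lambda (fun x : Fin m × Fin N → Fin p → ℝ => fun j => x (i, j))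
          fun j => measurable_pi_apply (i, j))
    refine ⟨E, hEm, hEμ, fun ω hω A hA => aggregationBound_hist hm hf hZ fun i C hC => ?_⟩
    obtain ⟨hU, hinj, hcount⟩ := hE ω hω
    obtain ⟨a, ha, hc, hn⟩ := (hA i).exists_path hK.le (fun j => hU (i, j))
      (fun q j j' h => (Prod.ext_iff.1 (hinj q (a₁ := (i, j)) (a₂ := (i, j')) h)).2) hC
    refine hcount i a ha C hc ?_
    -- The leaf holds at least `N / (2K) - 2` points, and `2 ≤ N / (10K)`, which leaves `2N / (5K)`.
    have hNK := (median_sample_size_le hK hδ hδ1 hN).1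
    have hK0 : (0 : ℝ) < K := by positivity
    rw [Fintype.card_fin] at hn
    rw [div_mul_eq_mul_div, div_le_iff₀ (by positivity)]
    linarith

/-- Median partitions of the pooled sample. -/
lemma kd_common (hm : 1 ≤ m) (hK : 1 ≤ K) (hf : ∀ i, IsDensity (f i))
    (hZ : 0 < Z f Finset.univ) (hX : ∀ i j, Measurable (X i j))
    (hlaw : ∀ i j, μ.map (X i j) = law (f i))
    (hindep : iIndepFun (fun ij : Fin m × Fin N => X ij.1 ij.2) μ)
    (hδ : 0 < δ) (hδ1 : δ < 1)
    (hN : 128 * Real.exp 1 ^ 2 * K * Real.log K ^ 2 * Real.log (K / δ) < N)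
    {dir : Ω → List Bool → Fin p} (hdir : Measurable dir)
    (hdirX : IndepFun dir (fun ω (ij : Fin m × Fin N) => X ij.1 ij.2 ω) μ) :
    ∃ E : Set Ω, MeasurableSet E ∧ ENNReal.ofReal (1 - m * δ) ≤ μ E ∧
      ∀ ω ∈ E, ∀ A : BoxIntegral.Prepartition (unitBox p),
        IsKDPartition (fun ij : Fin m × Fin N => X ij.1 ij.2 ω) (dir ω) K A →
        AggregationBound f fun i => hist (fun j => X i j ω) A := by
  rcases hK.eq_or_lt with rfl | hK
  · refine ⟨Set.univ, MeasurableSet.univ, ?_, fun ω _ A hA => ?_⟩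
    · rw [measure_univ, ← ENNReal.ofReal_one]
      exact ENNReal.ofReal_le_ofReal (by linarith [show 0 ≤ m * δ by positivity])
    · exact aggregationBound_hist hm hf hZ (A := fun _ => A) fun i C hC =>
        count_le_of_isKDPartition_one hf (i := i) hA hC
  · obtain ⟨E, hEm, hEμ, hE⟩ := exists_kd_event hK hf hX hlaw hindep hδ hδ1 hN
      (dir := fun _ => dir) (fun _ => hdir) fun i =>
      hdirX.comp measurable_id
        (measurable_pi_lambda (fun x : Fin m × Fin N → Fin p → ℝ => fun j => x (i, j))
          fun j => measurable_pi_apply (i, j))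
    refine ⟨E, hEm, hEμ, fun ω hω A hA =>
      aggregationBound_hist hm hf hZ (A := fun _ => A) fun i C hC => ?_⟩
    obtain ⟨hU, hinj, hcount⟩ := hE ω hω
    obtain ⟨a, ha, hc, hn⟩ := hA.exists_path hK.le hU hinj hC
    have hNK := (median_sample_size_le hK hδ hδ1 hN).1
    have hK0 : (0 : ℝ) < K := by positivity
    have hm1 : (1 : ℝ) ≤ m := by exact_mod_cast hm
    rw [Fintype.card_prod, Fintype.card_fin, Fintype.card_fin,
      count_prod (fun i j => X i j ω)] at hn
    push_cast at hn
    -- Pooled medians balance only the total count, so a leaf may be nearly empty in some samples.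
    -- By averaging it is well filled in at least one: otherwise `mN < (4/5) mN + 4K`, against `20K
    -- ≤ N`.
    obtain ⟨k, hk⟩ : ∃ k, 2 / (5 * K) * N ≤ (count (fun j => X k j ω) C : ℝ) := by
      by_contra! hlt
      have hsum : ∑ i, (count (fun j => X i j ω) C : ℝ) ≤ m * (2 / (5 * K) * N) :=
        (Finset.sum_le_sum fun i _ => (hlt i).le).trans_eq (by simp)
      have h1 : (m : ℝ) * N ≤ 2 * K * (m * (2 / (5 * K) * N) + 2) :=
        hn.trans (by gcongr)
      have h2 : 2 * K * (m * (2 / (5 * K) * N) + 2) = 4 / 5 * (m * N) + 4 * (K : ℝ) := by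
        field_simp
        ring
      have h3 : (N : ℝ) ≤ m * N := le_mul_of_one_le_left (by positivity) hm1
      obtain ⟨i₀⟩ : Nonempty (Fin m) := ⟨⟨0, hm⟩⟩
      have h4 : ∑ i, (count (fun j => X i j ω) C : ℝ) < m * (2 / (5 * K) * N) :=
        (Finset.sum_lt_sum_of_nonempty ⟨i₀, Finset.mem_univ _⟩ fun i _ => hlt i).trans_eq (by simp)
      have h5 : 2 * K * (∑ i, (count (fun j => X i j ω) C : ℝ) + 2) <
          2 * K * (m * (2 / (5 * K) * N) + 2) := by gcongr
      linarith
    -- A sample with few points in `C` has fewer there than sample `k`, and the bound for `k`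
    -- involves only `N`, `area C` and the common `maxSup f`.
    by_cases hi : 2 / (5 * K) * N ≤ (count (fun j => X i j ω) C : ℝ)
    · exact hcount i a ha C hc hi
    · exact (not_le.1 hi).le.trans (hk.trans (hcount k a ha C hc hk))

end

end PART

end

/-! ### The theorem, from the good events -/

theorem theorem3 {Ω : Type*} [MeasurableSpace Ω] (μ : Measure Ω) [IsProbabilityMeasure μ]
    (p m N K : ℕ) (hp : 1 ≤ p) (hm : 1 ≤ m) (hK : 1 ≤ K)
    -- the densities of the `m` subset posteriors, and the samples drawn from them
    (f : Fin m → (Fin p → ℝ) → ℝ) (hf : ∀ i, PART.IsDensity (f i))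
    (hZ : 0 < PART.Z f Finset.univ)
    (X : Fin m → Fin N → Ω → (Fin p → ℝ)) (hX : ∀ i j, Measurable (X i j))
    (hlaw : ∀ i j, μ.map (X i j) = PART.law (f i))
    (hindep : iIndepFun (fun (ij : Fin m × Fin N) => X ij.1 ij.2) μ)
    (δ : ℝ) (hδ : 0 < δ) :
    -- maximum likelihood partitions
    (∀ c₀ ρ : ℝ, 0 < c₀ → c₀ < 1 → ρ = 1 / (K : ℝ) ^ (1 + 1 / (2 * (p : ℝ))) →
      2 * ((1 - c₀) ^ 2)⁻¹ * (K : ℝ) ^ (1 + 1 / (2 * (p : ℝ))) * Real.log (2 * K / δ) < N →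
      32 * c₀⁻¹ * √(2 * (p + 1)) * (K : ℝ) ^ (3 / 2 + 1 / (2 * (p : ℝ))) *
        √(Real.log (3 * Real.exp 1 * N / K) * Real.log (8 / δ)) ≤ √(N : ℝ) →
      ∃ E : Set Ω, MeasurableSet E ∧ ENNReal.ofReal (1 - m * δ) ≤ μ E ∧
        ∀ ω ∈ E, ∀ η : ℝ, 0 ≤ η →
          -- one partition, common to all subsets
          (∀ A : BoxIntegral.Prepartition (PART.unitBox p),
            PART.IsMLPartition (fun i j => X i j ω) K c₀ ρ (PART.maxSup f) η A →
            PART.AggregationBound f (fun i => PART.hist (fun j => X i j ω) A)) ∧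
          -- a partition for each subset
          (∀ A : Fin m → BoxIntegral.Prepartition (PART.unitBox p),
            (∀ i, PART.IsMLPartition (fun (_ : Unit) j => X i j ω) K c₀ ρ
              (PART.supNorm (f i)) η (A i)) →
            PART.AggregationBound f (fun i => PART.hist (fun j => X i j ω) (A i)))) ∧
    -- median partitions
    (32 * Real.exp 1 ^ 2 * Real.log K ^ 2 * K * Real.log (2 * K / δ) < N →
      128 * Real.exp 1 ^ 2 * K * Real.log K ^ 2 * Real.log (K / δ) < N →
      -- one partition, common to all subsets, cut at the medians of the pooled samples
      (∀ dir : Ω → List Bool → Fin p, Measurable dir →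
        IndepFun dir (fun ω (ij : Fin m × Fin N) => X ij.1 ij.2 ω) μ →
        ∃ E : Set Ω, MeasurableSet E ∧ ENNReal.ofReal (1 - m * δ) ≤ μ E ∧
          ∀ ω ∈ E, ∀ A : BoxIntegral.Prepartition (PART.unitBox p),
            PART.IsKDPartition (fun (ij : Fin m × Fin N) => X ij.1 ij.2 ω) (dir ω) K A →
            PART.AggregationBound f (fun i => PART.hist (fun j => X i j ω) A)) ∧
      -- a partition for each subset, cut at the medians of the sample of that subset
      (∀ dir : Ω → Fin m → List Bool → Fin p, Measurable dir →
        IndepFun dir (fun ω (ij : Fin m × Fin N) => X ij.1 ij.2 ω) μ →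
        ∃ E : Set Ω, MeasurableSet E ∧ ENNReal.ofReal (1 - m * δ) ≤ μ E ∧
          ∀ ω ∈ E, ∀ A : Fin m → BoxIntegral.Prepartition (PART.unitBox p),
            (∀ i, PART.IsKDPartition (fun j => X i j ω) (dir ω i) K (A i)) →
            PART.AggregationBound f (fun i => PART.hist (fun j => X i j ω) (A i)))) := by
  -- If `1 ≤ m * δ`, the probability claim is trivial and the empty event works; otherwise `δ < 1`,
  -- as the estimates need.
  rcases le_or_gt 1 (m * δ) with hmδ | hmδ
  · have hempty : ENNReal.ofReal (1 - m * δ) ≤ μ ∅ := by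
      rw [ENNReal.ofReal_of_nonpos (by linarith)]
      exact zero_le
    refine ⟨fun c₀ ρ _ _ _ _ _ => ⟨∅, .empty, hempty, fun ω hω => hω.elim⟩, fun _ _ =>
      ⟨fun dir _ _ => ⟨∅, .empty, hempty, fun ω hω => hω.elim⟩,
        fun dir _ _ => ⟨∅, .empty, hempty, fun ω hω => hω.elim⟩⟩⟩
  have hm1 : (1 : ℝ) ≤ m := by exact_mod_cast hm
  have hδ1 : δ < 1 := (le_mul_of_one_le_left hδ.le hm1).trans_lt hmδ
  refine ⟨fun c₀ ρ hc₀ hc₁ hρ hN hN' => ?_, fun _ hN =>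
    ⟨fun dir hdir hdirX => PART.kd_common hm hK hf hZ hX hlaw hindep hδ hδ1 hN hdir hdirX,
      fun dir hdir hdirX => PART.kd_separate hm hK hf hZ hX hlaw hindep hδ hδ1 hN hdir hdirX⟩⟩
  obtain ⟨E, hEm, hEμ, hE⟩ := PART.exists_ml_event hp hK hf hX hlaw hindep hδ hδ1 hc₀ hc₁ hρ hN hN'
  have hsub : ∀ {A : BoxIntegral.Prepartition (PART.unitBox p)} {C : BoxIntegral.Box (Fin p)},
      C ∈ A → (C : Set (Fin p → ℝ)) ⊆ PART.unitBox p := fun hC _ hx =>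
    BoxIntegral.Prepartition.le_of_mem _ hC hx
  -- One event serves both kinds of partition, because it allows every `D ≥ supNorm (f i)`: `maxSup
  -- f` for a common partition and `supNorm (f i)` for a separate one.
  refine ⟨E, hEm, hEμ, fun ω hω η _ => ⟨fun A hA => ?_, fun A hA => ?_⟩⟩
  · exact PART.aggregationBound_hist hm hf hZ (A := fun _ => A) fun i C hC =>
      hE ω hω i _ (PART.supNorm_le_maxSup hf i) C (hsub hC) (hA.feasible.area_ge C hC)
  · refine PART.aggregationBound_hist hm hf hZ fun i C hC =>
      (hE ω hω i _ le_rfl C (hsub hC) ((hA i).feasible.area_ge C hC)).trans ?_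
    have := PART.area_pos C
    have := PART.supNorm_le_maxSup hf i
    gcongr
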